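/- **Setting.** Let $\mathcal A$ be a unital involutive complex algebra. A spectral triple $(\mathcal A,\mathcal H,\mathcal D)$ consists of a faithful unital $*$-representation $\pi$ of $\mathcal A$ by bounded operators on a separable complex Hilbert space $\mathcal H$ and a (possibly unbounded) self-adjoint operator $\mathcal D$ on $\mathcal H$ with compact resolvent such that, for every $a\in\mathcal A$, $\pi(a)$ preserves the domain of $\mathcal D$ and $[\mathcal D,\pi(a)]$ is bounded. Let $ds=|\mathcal D|^{-1}$ on $(\ker\mathcal D)^\perp$, extended by $0$ on $\ker\mathcal D$. Assume: * (dimension 3) the decreasing sequence of eigenvalues of $ds$ is $O(k^{-1/3})$; * (regularity) every element of the algebra generated by $\pi(\mathcal A)$ and $[\mathcal D,\pi(\mathcal A)]$ lies in the domain of every power of the derivation $b\mapsto[|\mathcal D|,b]$; * (closedness) $\mathrm{Tr}_\omega\big([\mathcal D,\pi(a_1)][\mathcal D,\pi(a_2)][\mathcal D,\pi(a_3)]\,ds^{3}\big)=0$ for all $a_1,a_2,a_3\in\mathcal A$. Here $\mathrm{Tr}_\omega$ is the Dixmier trace of a fixed positive linear form $\omega$ on bounded real sequences that extends the limit and satisfies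 $\omega(\alpha_0,\alpha_0,\alpha_1,\alpha_1,\dots)=\omega(\alpha_0,\alpha_1,\dots)$: for positive $T$ whose singular values $\mu_k(T)$ satisfy $\sum_{k<N}\mu_k(T)=O(\log N)$ it is $\omega\big(\frac1{\log N}\sum_{k<N}\mu_k(T)\big)$, and it is extended by linearity. For bounded $T$ put $$\int\!\!\!\!\!\!-\ T\,ds^3=\frac{\pi^{3/2}\,\Gamma(5/2)}{2^{2}}\,\mathrm{Tr}_\omega(T\,ds^{3}).$$ Let $\Omega(\mathcal A)=\bigoplus_k\Omega^k(\mathcal A)$ be the universal differential algebra of $\mathcal A$, spanned by the elements $a_0\,\delta a_1\cdots\delta a_k$, with $d(a_0\,\delta a_1\cdots\delta a_k)=\delta a_0\,\delta a_1\cdots\delta a_k$, represented by $\pi(a_0\,\delta a_1\cdots\delta a_k)=\pi(a_0)[\mathcal D,\pi(a_1)]\cdots[\mathcal D,\pi(a_k)]$. Let $J_0=\bigoplus_k\big(\ker\pi\cap\Omega^k(\mathcal A)\big)$, let $J=J_0+dJ_0$, which is a two-sided differential ideal, and let $\Omega_{\mathcal D}(\mathcal A)=\Omega(\mathcal A)/J$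 with the induced exterior derivative $d$. Since $\pi$ is faithful on $\mathcal A$, 1-forms $\Omega^1_{\mathcal D}(\mathcal A)$ are identified with operators. For $A\in M_N(\Omega^1_{\mathcal D}(\mathcal A))$, a representative of the Chern–Simons form $K=A\,dA+\frac23A^3\in M_N(\Omega^3_{\mathcal D}(\mathcal A))$ is a matrix $K_1=\pi(\kappa)$, where $\kappa\in M_N(\Omega^3(\mathcal A))$ has class $K$. The Chern–Simons action is $$S_{CS}[A]=\int\!\!\!\!\!\!-\ \mathrm{tr}(K_1)\,ds^3$$ for one such $K_1$, where $\mathrm{tr}$ is the trace of $N\times N$ matrices. **Theorem 3.1.** Let $A\in M_N(\Omega^1_{\mathcal D}(\mathcal A))$ be hermitian and let $u\in M_N(\mathcal A)$ be unitary. Then the gauge transform $uAu^{-1}+u\,du^{-1}$ is again hermitian, $S_{CS}[A]$ does not depend on the choice of the representative $K_1$, and $$S_{CS}[uAu^{-1}+u\,du^{-1}]=S_{CS}[A]+\Gamma[u],\qquad \Gamma[u]=-\frac13\int\!\!\!\!\!\!-\ \mathrm{tr}\big((u\,du^{-1})^3\big)\,ds^3,$$ where in $\Gamma[u]$ one has $u\,du^{-1}=\pi(u)[\mathcal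 D,\pi(u^{-1})]$, with $\pi$ and $[\mathcal D,\pi(\cdot)]$ applied entrywise. -/

import Mathlib

open scoped ComplexStarModule InnerProductSpace BoundedContinuousFunction Topology

namespace NCCS

/-! ### The universal differential algebra -/

section Universal

variable (A : Type*) [Ring A] [Algebra ℂ A]

/-- The defining relations of `Ω(A)` on the generators `a` (left copy of `A`) and `δ a`
(right copy of `A`). -/
inductive FormRel : FreeAlgebra ℂ (A ⊕ A) → FreeAlgebra ℂ (A ⊕ A) → Prop
  | algebraMap (c : ℂ) :
      FormRel (FreeAlgebra.ι ℂ (Sum.inl (algebraMap ℂ A c))) (algebraMap ℂ _ c)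
  | add (a b : A) : FormRel (FreeAlgebra.ι ℂ (Sum.inl (a + b)))
      (FreeAlgebra.ι ℂ (Sum.inl a) + FreeAlgebra.ι ℂ (Sum.inl b))
  | mul (a b : A) : FormRel (FreeAlgebra.ι ℂ (Sum.inl (a * b)))
      (FreeAlgebra.ι ℂ (Sum.inl a) * FreeAlgebra.ι ℂ (Sum.inl b))
  | delta_add (a b : A) : FormRel (FreeAlgebra.ι ℂ (Sum.inr (a + b)))
      (FreeAlgebra.ι ℂ (Sum.inr a) + FreeAlgebra.ι ℂ (Sum.inr b))
  | delta_smul (c : ℂ) (a : A) : FormRel (FreeAlgebra.ι ℂ (Sum.inr (c • a)))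
      (c • FreeAlgebra.ι ℂ (Sum.inr a))
  | leibniz (a b : A) : FormRel (FreeAlgebra.ι ℂ (Sum.inr (a * b)))
      (FreeAlgebra.ι ℂ (Sum.inr a) * FreeAlgebra.ι ℂ (Sum.inl b)
        + FreeAlgebra.ι ℂ (Sum.inl a) * FreeAlgebra.ι ℂ (Sum.inr b))
  | delta_one : FormRel (FreeAlgebra.ι ℂ (Sum.inr 1)) 0

/-- The universal differential algebra `Ω(A)` of a unital complex algebra `A`. -/
def UForm : Type _ := RingQuot (FormRel A)

variable {A}

namespace UForm

noncomputable instance : Ring (UForm A) := inferInstanceAs (Ring (RingQuot (FormRel A)))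

noncomputable instance : Algebra ℂ (UForm A) :=
  inferInstanceAs (Algebra ℂ (RingQuot (FormRel A)))

variable (A) in
/-- The projection from the free algebra. -/
noncomputable def mk : FreeAlgebra ℂ (A ⊕ A) →ₐ[ℂ] UForm A := RingQuot.mkAlgHom ℂ (FormRel A)

theorem mk_rel {x y : FreeAlgebra ℂ (A ⊕ A)} (h : FormRel A x y) : mk A x = mk A y :=
  RingQuot.mkAlgHom_rel ℂ h

/-- The inclusion `A → Ω(A)` in degree zero. -/
noncomputable def incl : A →ₐ[ℂ] UForm A where
  toFun a := mk A (FreeAlgebra.ι ℂ (Sum.inl a))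
  map_one' := by
    have h := mk_rel (FormRel.algebraMap (A := A) 1)
    simpa using h
  map_zero' := by
    have h := mk_rel (FormRel.algebraMap (A := A) 0)
    simpa using h
  map_mul' a b := by
    rw [mk_rel (FormRel.mul a b), map_mul]
  map_add' a b := by
    rw [mk_rel (FormRel.add a b), map_add]
  commutes' c := by
    rw [mk_rel (FormRel.algebraMap c), AlgHom.commutes]

/-- The universal derivation `δ : A → Ω(A)`. -/
noncomputable def delta : A →ₗ[ℂ] UForm A where
  toFun a := mk A (FreeAlgebra.ι ℂ (Sum.inr a))
  map_add' a b := by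
    rw [mk_rel (FormRel.delta_add a b), map_add]
  map_smul' c a := by
    rw [mk_rel (FormRel.delta_smul c a), map_smul, RingHom.id_apply]

theorem delta_mul (a b : A) : delta (a * b) = delta a * incl b + incl a * delta b := by
  change mk A (FreeAlgebra.ι ℂ (Sum.inr (a * b))) = _
  rw [mk_rel (FormRel.leibniz a b), map_add, map_mul, map_mul]
  rfl

theorem delta_one : delta (1 : A) = 0 := by
  change mk A (FreeAlgebra.ι ℂ (Sum.inr 1)) = _
  rw [mk_rel FormRel.delta_one, map_zero]

section Lift

variable {B : Type*} [Ring B] [Algebra ℂ B]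

/-- The universal property of `Ω(A)`. -/
noncomputable def lift (f : A →ₐ[ℂ] B) (g : A →ₗ[ℂ] B) (hg : ∀ a b, g (a * b) = g a * f b + f a * g b) :
    UForm A →ₐ[ℂ] B :=
  RingQuot.liftAlgHom ℂ ⟨FreeAlgebra.lift ℂ (Sum.elim f g), by
    have g1 : g 1 = 0 := by simpa using hg 1 1
    intro x y h
    cases h <;> simp [hg, g1]⟩

variable (f : A →ₐ[ℂ] B) (g : A →ₗ[ℂ] B) (hg : ∀ a b, g (a * b) = g a * f b + f a * g b)

theorem lift_incl (a : A) : lift f g hg (incl a) = f a := by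
  refine (RingQuot.liftAlgHom_mkAlgHom_apply ℂ _ _ _).trans ?_
  simp

theorem lift_delta (a : A) : lift f g hg (delta a) = g a := by
  refine (RingQuot.liftAlgHom_mkAlgHom_apply ℂ _ _ _).trans ?_
  simp

end Lift

theorem induction {P : UForm A → Prop} (hi : ∀ a, P (incl a)) (hd : ∀ a, P (delta a))
    (hadd : ∀ x y, P x → P y → P (x + y)) (hmul : ∀ x y, P x → P y → P (x * y)) (x : UForm A) :
    P x := by
  have hs : Function.Surjective (mk A) := RingQuot.mkAlgHom_surjective ℂ (FormRel A)
  obtain ⟨y, rfl⟩ := hs x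
  induction y using FreeAlgebra.induction with
  | grade0 c =>
    rw [(mk A).commutes, ← (incl (A := A)).commutes]
    exact hi _
  | grade1 s =>
    rcases s with a | a
    · exact hi a
    · exact hd a
  | mul x y hx hy => rw [map_mul]; exact hmul _ _ hx hy
  | add x y hx hy => rw [map_add]; exact hadd _ _ hx hy

/-- The grading automorphism, equal to `(-1)^k` on forms of degree `k`. -/
noncomputable def sgn : UForm A →ₐ[ℂ] UForm A :=
  lift incl (-delta) (by
    intro a b
    simp only [LinearMap.neg_apply, delta_mul]
    rw [neg_add, neg_mul, mul_neg])

theorem sgn_incl (a : A) : sgn (incl a) = incl a := lift_incl _ _ _ a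

theorem sgn_delta (a : A) : sgn (delta a) = -delta a := lift_delta _ _ _ a

/-- The algebra morphism `ω ↦ !![sgn ω, dω; 0, ω]`, which encodes the graded Leibniz rule. -/
noncomputable def mat : UForm A →ₐ[ℂ] Matrix (Fin 2) (Fin 2) (UForm A) :=
  lift
    { toFun := fun a => !![incl a, delta a; 0, incl a]
      map_one' := by
        rw [map_one, delta_one, Matrix.one_fin_two]
      map_zero' := by
        ext i j; fin_cases i <;> fin_cases j <;> simp
      map_mul' := by
        intro a b
        rw [Matrix.mul_fin_two]
        ext i j; fin_cases i <;> fin_cases j <;> simp [delta_mul, add_comm]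
      map_add' := by
        intro a b
        ext i j; fin_cases i <;> fin_cases j <;> simp
      commutes' := by
        intro c
        have h : delta (algebraMap ℂ A c) = 0 := by
          rw [Algebra.algebraMap_eq_smul_one, map_smul, delta_one, smul_zero]
        ext i j; fin_cases i <;> fin_cases j <;> simp [h, Matrix.algebraMap_matrix_apply] }
    { toFun := fun a => !![-delta a, 0; 0, delta a]
      map_add' := by
        intro a b
        ext i j; fin_cases i <;> fin_cases j <;> simp [add_comm]
      map_smul' := by
        intro c a
        ext i j; fin_cases i <;> fin_cases j <;> simp }
    (by
      intro a b
      simp only [AlgHom.coe_mk, RingHom.coe_mk, MonoidHom.coe_mk, OneHom.coe_mk,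
        LinearMap.coe_mk, AddHom.coe_mk, Matrix.mul_fin_two]
      ext i j; fin_cases i <;> fin_cases j <;> simp [delta_mul, add_comm])

/-- The exterior derivative `d(a₀ δa₁ ⋯ δa_k) = δa₀ δa₁ ⋯ δa_k` of `Ω(A)`. -/
noncomputable def d : UForm A →ₗ[ℂ] UForm A where
  toFun x := mat x 0 1
  map_add' x y := by simp
  map_smul' c x := by simp

theorem mat_incl (a : A) : mat (incl a) = !![incl a, delta a; 0, incl a] :=
  lift_incl _ _ _ a

theorem mat_delta (a : A) : mat (delta a) = !![-delta a, 0; 0, delta a] :=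
  lift_delta _ _ _ a

theorem mat_eq (x : UForm A) : mat x = !![sgn x, d x; 0, x] := by
  have key : mat x 0 0 = sgn x ∧ mat x 1 0 = 0 ∧ mat x 1 1 = x := by
    induction x using induction with
    | hi a => simp [mat_incl, sgn_incl]
    | hd a => simp [mat_delta, sgn_delta]
    | hadd x y hx hy => simp [hx, hy]
    | hmul x y hx hy => simp [Matrix.mul_apply, Fin.sum_univ_two, hx, hy]
  ext i j; fin_cases i <;> fin_cases j <;> simp [key, d]

theorem d_incl (a : A) : d (incl a) = delta a := by
  change mat (incl a) 0 1 = _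
  simp [mat_incl]

theorem d_delta (a : A) : d (delta a) = 0 := by
  change mat (delta a) 0 1 = _
  simp [mat_delta]

theorem d_mul (x y : UForm A) : d (x * y) = d x * y + sgn x * d y := by
  change mat (x * y) 0 1 = _
  rw [map_mul, mat_eq x, mat_eq y, Matrix.mul_fin_two]
  simp [add_comm]

theorem sgn_sgn (x : UForm A) : sgn (sgn x) = x := by
  induction x using induction with
  | hi a => simp [sgn_incl]
  | hd a => simp [sgn_delta]
  | hadd x y hx hy => simp [hx, hy]
  | hmul x y hx hy => simp [hx, hy]

theorem sgn_d (x : UForm A) : sgn (d x) = -d (sgn x) := by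
  induction x using induction with
  | hi a => simp [sgn_incl, d_incl, sgn_delta]
  | hd a => simp [sgn_delta, d_delta]
  | hadd x y hx hy => simp [hx, hy, add_comm]
  | hmul x y hx hy => simp [hx, hy, d_mul, add_comm]

theorem d_d (x : UForm A) : d (d x) = 0 := by
  induction x using induction with
  | hi a => simp [d_incl, d_delta]
  | hd a => simp [d_delta]
  | hadd x y hx hy => simp [hx, hy]
  | hmul x y hx hy => simp [hx, hy, d_mul, sgn_d]

variable (A) in
/-- `Ω^k(A)`, the linear span of the elements `a₀ δa₁ ⋯ δa_k`. -/
noncomputable def degree (k : ℕ) : Submodule ℂ (UForm A) :=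
  LinearMap.range (incl (A := A)).toLinearMap * LinearMap.range (delta (A := A)) ^ k

theorem delta_incl_le :
    LinearMap.range (delta (A := A)) * LinearMap.range (incl (A := A)).toLinearMap ≤
      LinearMap.range (incl (A := A)).toLinearMap * LinearMap.range (delta (A := A)) := by
  rw [Submodule.mul_le]
  rintro _ ⟨a, rfl⟩ _ ⟨b, rfl⟩
  have h : delta a * incl b = incl 1 * delta (a * b) - incl a * delta b := by
    rw [map_one, one_mul, delta_mul, add_sub_cancel_right]
  change delta a * incl b ∈ _
  rw [h]
  exact sub_mem (Submodule.mul_mem_mul ⟨1, rfl⟩ ⟨_, rfl⟩)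
    (Submodule.mul_mem_mul ⟨a, rfl⟩ ⟨_, rfl⟩)

theorem incl_incl_le :
    LinearMap.range (incl (A := A)).toLinearMap * LinearMap.range (incl (A := A)).toLinearMap ≤
      LinearMap.range (incl (A := A)).toLinearMap := by
  rw [Submodule.mul_le]
  rintro _ ⟨a, rfl⟩ _ ⟨b, rfl⟩
  exact ⟨a * b, by simp⟩

theorem delta_pow_incl_le (k : ℕ) :
    LinearMap.range (delta (A := A)) ^ k * LinearMap.range (incl (A := A)).toLinearMap ≤
      LinearMap.range (incl (A := A)).toLinearMap * LinearMap.range (delta (A := A)) ^ k := by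
  induction k with
  | zero => simp
  | succ k ih =>
    rw [pow_succ, mul_assoc]
    refine (mul_le_mul' le_rfl delta_incl_le).trans ?_
    rw [← mul_assoc, ← mul_assoc]
    exact mul_le_mul' ih le_rfl

theorem mul_mem_degree {p q : ℕ} {x y : UForm A} (hx : x ∈ degree A p) (hy : y ∈ degree A q) :
    x * y ∈ degree A (p + q) := by
  have h : degree A p * degree A q ≤ degree A (p + q) := by
    unfold degree
    rw [pow_add]
    calc _ = LinearMap.range (incl (A := A)).toLinearMap *
            (LinearMap.range (delta (A := A)) ^ p * LinearMap.range (incl (A := A)).toLinearMap) *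
              LinearMap.range (delta (A := A)) ^ q := by simp only [mul_assoc]
      _ ≤ LinearMap.range (incl (A := A)).toLinearMap *
            (LinearMap.range (incl (A := A)).toLinearMap * LinearMap.range (delta (A := A)) ^ p) *
              LinearMap.range (delta (A := A)) ^ q :=
          mul_le_mul' (mul_le_mul' le_rfl (delta_pow_incl_le p)) le_rfl
      _ = LinearMap.range (incl (A := A)).toLinearMap *
            LinearMap.range (incl (A := A)).toLinearMap *
              (LinearMap.range (delta (A := A)) ^ p * LinearMap.range (delta (A := A)) ^ q) := by
          simp only [mul_assoc]
      _ ≤ _ := mul_le_mul' incl_incl_le le_rfl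
  exact h (Submodule.mul_mem_mul hx hy)

theorem incl_mem (a : A) : incl a ∈ degree A 0 := by
  unfold degree
  rw [pow_zero, mul_one]
  exact ⟨a, rfl⟩

theorem delta_mem (a : A) : delta a ∈ degree A 1 := by
  unfold degree
  rw [pow_one]
  have h : delta a = incl 1 * delta a := by simp
  rw [h]
  exact Submodule.mul_mem_mul ⟨1, rfl⟩ ⟨a, rfl⟩

theorem iSup_degree : ⨆ k, degree A k = ⊤ := by
  rw [eq_top_iff]
  rintro x -
  induction x using induction with
  | hi a => exact Submodule.mem_iSup_of_mem 0 (incl_mem a)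
  | hd a => exact Submodule.mem_iSup_of_mem 1 (delta_mem a)
  | hadd x y hx hy => exact add_mem hx hy
  | hmul x y hx hy =>
    induction hx using Submodule.iSup_induction' with
    | zero => simp
    | add x x' _ _ h h' => rw [add_mul]; exact add_mem h h'
    | mem p x hx =>
      induction hy using Submodule.iSup_induction' with
      | zero => simp
      | add y y' _ _ h h' => rw [mul_add]; exact add_mem h h'
      | mem q y hy => exact Submodule.mem_iSup_of_mem (p + q) (mul_mem_degree hx hy)

theorem sgn_of_mem {k : ℕ} {x : UForm A} (hx : x ∈ degree A k) : sgn x = (-1 : ℂ) ^ k • x := by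
  have h1 : ∀ k : ℕ, ∀ y ∈ LinearMap.range (delta (A := A)) ^ k, sgn y = (-1 : ℂ) ^ k • y := by
    intro k
    induction k with
    | zero =>
      intro y hy
      rw [pow_zero, Submodule.mem_one] at hy
      obtain ⟨c, rfl⟩ := hy
      simp
    | succ k ih =>
      intro y hy
      rw [pow_succ] at hy
      induction hy using Submodule.mul_induction_on' with
      | mem_mul_mem m hm n hn =>
        obtain ⟨a, rfl⟩ := hn
        rw [map_mul, ih m hm, sgn_delta, pow_succ]
        simp
      | add x _ y _ hx hy => rw [map_add, hx, hy, smul_add]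
  unfold degree at hx
  induction hx using Submodule.mul_induction_on' with
  | mem_mul_mem m hm n hn =>
    obtain ⟨a, rfl⟩ := hm
    change sgn (incl a * n) = _ • (incl a * n)
    rw [map_mul, h1 k n hn, sgn_incl, mul_smul_comm]
  | add x _ y _ hx hy => rw [map_add, hx, hy, smul_add]

theorem d_mem {k : ℕ} {x : UForm A} (hx : x ∈ degree A k) : d x ∈ degree A (k + 1) := by
  have h1 : ∀ k : ℕ, ∀ y ∈ LinearMap.range (delta (A := A)) ^ k, d y = 0 := by
    intro k
    induction k with
    | zero =>
      intro y hy
      rw [pow_zero, Submodule.mem_one] at hy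
      obtain ⟨c, rfl⟩ := hy
      rw [← (incl (A := A)).commutes, d_incl, Algebra.algebraMap_eq_smul_one, map_smul,
        delta_one, smul_zero]
    | succ k ih =>
      intro y hy
      rw [pow_succ] at hy
      induction hy using Submodule.mul_induction_on' with
      | mem_mul_mem m hm n hn =>
        obtain ⟨a, rfl⟩ := hn
        rw [d_mul, ih m hm, d_delta]
        simp
      | add x _ y _ hx hy => rw [map_add, hx, hy, add_zero]
  unfold degree at hx
  induction hx using Submodule.mul_induction_on' with
  | mem_mul_mem m hm n hn =>
    obtain ⟨a, rfl⟩ := hm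
    change d (incl a * n) ∈ _
    rw [d_mul, h1 k n hn, mul_zero, add_zero, d_incl, ← one_mul (delta a * n)]
    unfold degree
    rw [pow_succ']
    exact Submodule.mul_mem_mul ⟨1, by simp⟩ (Submodule.mul_mem_mul ⟨a, rfl⟩ hn)
  | add x _ y _ hx hy => rw [map_add]; exact add_mem hx hy

end UForm

end Universal

/-! ### Spectral triples -/

section Triple

variable {H : Type*} [NormedAddCommGroup H] [InnerProductSpace ℂ H]

/-- The bounded operator `c` is the commutator `[T, b]` of the unbounded operator `T` with the
bounded operator `b`: `b` preserves the domain of `T`, and `T b - b T = c` on that domain. -/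
def IsCommutator (T : H →ₗ.[ℂ] H) (b c : H →L[ℂ] H) : Prop :=
  ∀ x : T.domain, ∃ h : b x ∈ T.domain, T ⟨b x, h⟩ - b (T x) = c x

/-- The bounded operator `R` is the resolvent `(T - z)⁻¹`. -/
def IsResolvent (T : H →ₗ.[ℂ] H) (z : ℂ) (R : H →L[ℂ] H) : Prop :=
  (∀ y, ∃ h : R y ∈ T.domain, T ⟨R y, h⟩ - z • R y = y) ∧
    ∀ x : T.domain, R (T x - z • (x : H)) = x

/-- A spectral triple `(A, H, D)` over the unital involutive algebra `A`. -/
structure SpectralTriple (A : Type*) [Ring A] [Algebra ℂ A] [StarRing A] [StarModule ℂ A]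
    (H : Type*) [NormedAddCommGroup H] [InnerProductSpace ℂ H] [CompleteSpace H]
    [TopologicalSpace.SeparableSpace H] where
  /-- the representation of `A` by bounded operators -/
  rep : A →⋆ₐ[ℂ] (H →L[ℂ] H)
  faithful : Function.Injective rep
  /-- the Dirac operator, an unbounded operator -/
  dirac : H →ₗ.[ℂ] H
  selfAdjoint : IsSelfAdjoint dirac
  compactResolvent : ∀ z : ℂ, z.im ≠ 0 →
    ∃ R : H →L[ℂ] H, IsResolvent dirac z R ∧ IsCompactOperator R
  bounded_commutator : ∀ a : A, ∃ c : H →L[ℂ] H, IsCommutator dirac (rep a) c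

variable {A : Type*} [Ring A] [Algebra ℂ A] [StarRing A] [StarModule ℂ A]
variable [CompleteSpace H] [TopologicalSpace.SeparableSpace H]

namespace SpectralTriple

variable (S : SpectralTriple A H)

theorem isFormalAdjoint : S.dirac.IsFormalAdjoint S.dirac := by
  have h := LinearPMap.adjoint_isFormalAdjoint S.selfAdjoint.dense_domain
  rwa [LinearPMap.isSelfAdjoint_def.1 S.selfAdjoint] at h

theorem commutator_unique {b c c' : H →L[ℂ] H} (h : IsCommutator S.dirac b c)
    (h' : IsCommutator S.dirac b c') : c = c' := by
  refine ContinuousLinearMap.ext fun x => ?_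
  refine congrFun (Continuous.ext_on S.selfAdjoint.dense_domain c.continuous c'.continuous ?_) x
  intro y hy
  obtain ⟨_, e⟩ := h ⟨y, hy⟩
  obtain ⟨_, e'⟩ := h' ⟨y, hy⟩
  exact e.symm.trans e'

theorem commutator_spec (a : A) :
    IsCommutator S.dirac (S.rep a) (S.bounded_commutator a).choose :=
  (S.bounded_commutator a).choose_spec

theorem isCommutator_add {b b' c c' : H →L[ℂ] H} (h : IsCommutator S.dirac b c)
    (h' : IsCommutator S.dirac b' c') : IsCommutator S.dirac (b + b') (c + c') := by
  intro x
  obtain ⟨m, e⟩ := h x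
  obtain ⟨m', e'⟩ := h' x
  refine ⟨S.dirac.domain.add_mem m m', ?_⟩
  have : S.dirac ⟨(b + b') x, S.dirac.domain.add_mem m m'⟩
      = S.dirac ⟨b x, m⟩ + S.dirac ⟨b' x, m'⟩ := (S.dirac.map_add ⟨b x, m⟩ ⟨b' x, m'⟩)
  rw [this, add_apply, add_apply, ← e, ← e']
  abel

theorem isCommutator_smul (z : ℂ) {b c : H →L[ℂ] H} (h : IsCommutator S.dirac b c) :
    IsCommutator S.dirac (z • b) (z • c) := by
  intro x
  obtain ⟨m, e⟩ := h x
  refine ⟨S.dirac.domain.smul_mem z m, ?_⟩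
  have : S.dirac ⟨(z • b) x, S.dirac.domain.smul_mem z m⟩ = z • S.dirac ⟨b x, m⟩ :=
    S.dirac.map_smul z ⟨b x, m⟩
  rw [this, smul_apply, smul_apply, ← e, smul_sub]

theorem isCommutator_mul {b b' c c' : H →L[ℂ] H} (h : IsCommutator S.dirac b c)
    (h' : IsCommutator S.dirac b' c') : IsCommutator S.dirac (b * b') (c * b' + b * c') := by
  intro x
  obtain ⟨m', e'⟩ := h' x
  obtain ⟨m, e⟩ := h ⟨b' x, m'⟩
  refine ⟨m, ?_⟩
  change S.dirac ⟨b (b' x), m⟩ - b (b' (S.dirac x)) = c (b' x) + b (c' x)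
  rw [← e, ← e', map_sub]
  abel

/-- The differential `a ↦ [D, π(a)]`. -/
noncomputable def comm : A →ₗ[ℂ] (H →L[ℂ] H) where
  toFun a := (S.bounded_commutator a).choose
  map_add' a b := S.commutator_unique (S.commutator_spec (a + b)) (by
    rw [map_add]
    exact S.isCommutator_add (S.commutator_spec a) (S.commutator_spec b))
  map_smul' z a := S.commutator_unique (S.commutator_spec (z • a)) (by
    rw [map_smul]
    exact S.isCommutator_smul z (S.commutator_spec a))

theorem comm_spec (a : A) : IsCommutator S.dirac (S.rep a) (S.comm a) := S.commutator_spec a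

theorem comm_mul (a b : A) : S.comm (a * b) = S.comm a * S.rep b + S.rep a * S.comm b :=
  S.commutator_unique (S.comm_spec (a * b)) (by
    rw [map_mul]
    exact S.isCommutator_mul (S.comm_spec a) (S.comm_spec b))

/-! ### The operators `|D|` and `ds = |D|⁻¹` -/

/-- The eigenspace `ker (D - t)`, for real `t`. -/
def eigenspace (t : ℝ) : Submodule ℂ H where
  carrier := {x | ∃ h : x ∈ S.dirac.domain, S.dirac ⟨x, h⟩ = (t : ℂ) • x}
  zero_mem' := ⟨zero_mem _, by
    rw [smul_zero]
    exact S.dirac.map_zero⟩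
  add_mem' := by
    rintro x y ⟨hx, ex⟩ ⟨hy, ey⟩
    refine ⟨add_mem hx hy, ?_⟩
    have : S.dirac ⟨x + y, add_mem hx hy⟩ = S.dirac ⟨x, hx⟩ + S.dirac ⟨y, hy⟩ :=
      S.dirac.map_add ⟨x, hx⟩ ⟨y, hy⟩
    rw [this, ex, ey, smul_add]
  smul_mem' := by
    rintro z x ⟨hx, ex⟩
    refine ⟨Submodule.smul_mem _ z hx, ?_⟩
    have : S.dirac ⟨z • x, Submodule.smul_mem _ z hx⟩ = z • S.dirac ⟨x, hx⟩ :=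
      S.dirac.map_smul z ⟨x, hx⟩
    rw [this, ex, smul_comm]

theorem resolvent_eigenspace {R : H →L[ℂ] H} (hR : IsResolvent S.dirac Complex.I R) {t : ℝ}
    {x : H} : x ∈ S.eigenspace t ↔ ((t : ℂ) - Complex.I) • R x = x := by
  constructor
  · rintro ⟨h, e⟩
    have := hR.2 ⟨x, h⟩
    rw [e, ← sub_smul, map_smul] at this
    exact this
  · intro e
    obtain ⟨m, f⟩ := hR.1 x
    have hx : x ∈ S.dirac.domain := by
      rw [← e]
      exact Submodule.smul_mem _ _ m
    refine ⟨hx, ?_⟩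
    have h1 : S.dirac ⟨x, hx⟩ = ((t : ℂ) - Complex.I) • S.dirac ⟨R x, m⟩ := by
      rw [← S.dirac.map_smul]
      congr 1
      exact Subtype.ext e.symm
    rw [h1, sub_eq_iff_eq_add.1 f, smul_add, smul_comm, e, sub_smul]
    abel

theorem exists_resolvent : ∃ R : H →L[ℂ] H, IsResolvent S.dirac Complex.I R ∧
    IsCompactOperator R := S.compactResolvent Complex.I (by simp)

instance (t : ℝ) : CompleteSpace (S.eigenspace t) := by
  obtain ⟨R, hR, -⟩ := S.exists_resolvent
  have h : ((S.eigenspace t : Submodule ℂ H) : Set H) =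
      {x | ((t : ℂ) - Complex.I) • R x = x} := Set.ext fun x => S.resolvent_eigenspace hR
  have hc : IsClosed ((S.eigenspace t : Submodule ℂ H) : Set H) := by
    rw [h]
    exact isClosed_eq (by fun_prop) continuous_id
  exact hc.completeSpace_coe

/-- The orthogonal projection onto `ker (D - t)`. -/
noncomputable def proj (t : ℝ) : H →L[ℂ] H := (S.eigenspace t).starProjection

theorem proj_mem (t : ℝ) (x : H) : S.proj t x ∈ S.eigenspace t :=
  Submodule.starProjection_apply_mem _ _

theorem orthogonalFamily :
    OrthogonalFamily ℂ (fun t : ℝ => S.eigenspace t) fun t => (S.eigenspace t).subtypeₗᵢ := by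
  rintro s t hst ⟨x, hx, ex⟩ ⟨y, hy, ey⟩
  have h := S.isFormalAdjoint ⟨x, hx⟩ ⟨y, hy⟩
  rw [ex, ey] at h
  change inner ℂ ((s : ℂ) • x) y = inner ℂ x ((t : ℂ) • y) at h
  rw [inner_smul_left, inner_smul_right, Complex.conj_ofReal] at h
  change inner ℂ x y = 0
  have h' : ((s : ℂ) - t) * inner ℂ x y = 0 := by rw [sub_mul, h, sub_self]
  rcases mul_eq_zero.1 h' with h0 | h0
  · exact absurd (by exact_mod_cast sub_eq_zero.1 h0) hst
  · exact h0

theorem bessel (x : H) (s : Finset ℝ) : ∑ t ∈ s, ‖S.proj t x‖ ^ 2 ≤ ‖x‖ ^ 2 := by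
  have h1 : ‖∑ t ∈ s, S.proj t x‖ ^ 2 = ∑ t ∈ s, ‖S.proj t x‖ ^ 2 :=
    S.orthogonalFamily.norm_sum (fun t => ⟨S.proj t x, S.proj_mem t x⟩) s
  have h2 : inner ℂ x (∑ t ∈ s, S.proj t x) = ((∑ t ∈ s, ‖S.proj t x‖ ^ 2 : ℝ) : ℂ) := by
    rw [inner_sum, Complex.ofReal_sum]
    refine Finset.sum_congr rfl fun t _ => ?_
    have h3 : inner ℂ (x - S.proj t x) (S.proj t x) = 0 :=
      Submodule.starProjection_inner_eq_zero x _ (S.proj_mem t x)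
    rw [inner_sub_left, sub_eq_zero] at h3
    rw [h3, inner_self_eq_norm_sq_to_K]
    norm_cast
  have h4 : ∑ t ∈ s, ‖S.proj t x‖ ^ 2 ≤ ‖x‖ * ‖∑ t ∈ s, S.proj t x‖ := by
    have := norm_inner_le_norm (𝕜 := ℂ) x (∑ t ∈ s, S.proj t x)
    rw [h2, Complex.norm_real] at this
    exact (le_abs_self _).trans this
  rw [← h1] at h4 ⊢
  rcases (norm_nonneg (∑ t ∈ s, S.proj t x)).eq_or_lt with h0 | h0
  · rw [← h0, zero_pow two_ne_zero]
    exact sq_nonneg _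
  · have : ‖∑ t ∈ s, S.proj t x‖ ≤ ‖x‖ := by nlinarith
    gcongr

theorem summable_proj_sq (x : H) : Summable fun t => ‖S.proj t x‖ ^ 2 :=
  summable_of_sum_le (fun _ => sq_nonneg _) (S.bessel x)

theorem summable_smul_proj_iff (f : ℝ → ℝ) (x : H) :
    (Summable fun t => (f t : ℂ) • S.proj t x) ↔ Summable fun t => ‖(f t : ℂ) • S.proj t x‖ ^ 2 :=
  S.orthogonalFamily.summable_iff_norm_sq_summable
    fun t => ⟨(f t : ℂ) • S.proj t x, Submodule.smul_mem _ _ (S.proj_mem t x)⟩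

/-- The spectral calculus of `D`: since `D` has compact resolvent, `H` is the Hilbert sum of the
eigenspaces of `D`, and `f(D)` is the operator `x ↦ ∑ f(t) P_t x` with its natural domain, where
`P_t` is the orthogonal projection onto `ker (D - t)`. -/
noncomputable def spectralCalc (f : ℝ → ℝ) : H →ₗ.[ℂ] H where
  domain :=
    { carrier := {x | Summable fun t => ‖(f t : ℂ) • S.proj t x‖ ^ 2}
      zero_mem' := by simp [summable_zero]
      add_mem' := by
        intro x y hx hy
        change Summable _ at hx hy
        change Summable _
        rw [← S.summable_smul_proj_iff] at hx hy ⊢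
        simpa only [map_add, smul_add] using hx.add hy
      smul_mem' := by
        intro z x hx
        change Summable _ at hx
        change Summable _
        rw [← S.summable_smul_proj_iff] at hx ⊢
        simpa only [map_smul, smul_comm _ z] using hx.const_smul z }
  toFun :=
    { toFun := fun x => ∑' t, (f t : ℂ) • S.proj t x
      map_add' := by
        rintro ⟨x, hx⟩ ⟨y, hy⟩
        change Summable _ at hx hy
        rw [← S.summable_smul_proj_iff] at hx hy
        simpa only [map_add, smul_add, Submodule.coe_add] using hx.tsum_add hy
      map_smul' := by
        rintro z ⟨x, hx⟩
        change Summable _ at hx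
        rw [← S.summable_smul_proj_iff] at hx
        simpa only [map_smul, smul_comm _ z, Submodule.coe_smul, RingHom.id_apply]
          using hx.tsum_const_smul z }

/-- The unbounded operator `|D|`. -/
noncomputable def absDirac : H →ₗ.[ℂ] H := S.spectralCalc fun t => |t|

/-- `D` has a spectral gap at `0`. -/
theorem spectral_gap : ∃ c : ℝ, 0 < c ∧ ∀ t : ℝ, t ≠ 0 → S.eigenspace t ≠ ⊥ → c ≤ |t| := by
  obtain ⟨R, hR, hc⟩ := S.exists_resolvent
  have hfin : {t : ℝ | |t| ≤ 1 ∧ S.eigenspace t ≠ ⊥}.Finite := by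
    by_contra hinf
    have hinf : {t : ℝ | |t| ≤ 1 ∧ S.eigenspace t ≠ ⊥}.Infinite := hinf
    let φ := hinf.natEmbedding
    have hex : ∀ n, ∃ x ∈ S.eigenspace (φ n : ℝ), ‖x‖ = 1 := by
      intro n
      obtain ⟨x, hx, hx0⟩ := Submodule.exists_mem_ne_zero_of_ne_bot (φ n).2.2
      refine ⟨((‖x‖⁻¹ : ℝ) : ℂ) • x, Submodule.smul_mem _ _ hx, ?_⟩
      rw [norm_smul, Complex.norm_real, norm_inv, norm_norm,
        inv_mul_cancel₀ (norm_ne_zero_iff.2 hx0)]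
    choose e he hn using hex
    have hK := hc.isCompact_closure_image_closedBall (r := 1)
    have hmem : ∀ n, R (e n) ∈ closure (R '' Metric.closedBall (0 : H) 1) := fun n =>
      subset_closure ⟨e n, by simp [hn n], rfl⟩
    obtain ⟨y, -, ψ, hψ, hlim⟩ := hK.tendsto_subseq hmem
    have hcau := hlim.cauchySeq
    obtain ⟨N, hN⟩ := Metric.cauchySeq_iff'.1 hcau 1 one_pos
    have h1 := hN (N + 1) (Nat.le_succ N)
    set m := ψ (N + 1) with hm
    set k := ψ N with hk
    have hmk : m ≠ k := fun h => by
      have := hψ.injective h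
      omega
    have key : ∀ n, ∃ z : ℂ, R (e n) = z • e n ∧ 1 / 2 ≤ ‖z‖ ^ 2 := by
      intro n
      have hz : ((φ n : ℝ) : ℂ) - Complex.I ≠ 0 := by
        intro h
        have := congrArg Complex.im h
        simp at this
      refine ⟨(((φ n : ℝ) : ℂ) - Complex.I)⁻¹, ?_, ?_⟩
      · rw [eq_inv_smul_iff₀ hz]
        exact (S.resolvent_eigenspace hR).1 (he n)
      · have h2 : ‖((φ n : ℝ) : ℂ) - Complex.I‖ ^ 2 = (φ n : ℝ) ^ 2 + 1 := by
          rw [← Complex.normSq_eq_norm_sq, Complex.normSq_apply]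
          simp
          ring
        have h3 : (φ n : ℝ) ^ 2 ≤ 1 := by
          have := (φ n).2.1
          rw [← sq_abs]
          nlinarith [abs_nonneg (φ n : ℝ)]
        rw [norm_inv, inv_pow, h2, one_div]
        exact inv_anti₀ (by positivity) (by linarith)
    obtain ⟨z, hz, hz'⟩ := key m
    obtain ⟨w, hw, hw'⟩ := key k
    have horth : inner ℂ (e m) (e k) = 0 :=
      S.orthogonalFamily (fun h => hmk (φ.injective (Subtype.ext h)))
        (⟨e m, he m⟩ : S.eigenspace (φ m)) (⟨e k, he k⟩ : S.eigenspace (φ k))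
    have h5 : ‖R (e m) - R (e k)‖ ^ 2 = ‖z‖ ^ 2 + ‖w‖ ^ 2 := by
      rw [hz, hw, @norm_sub_sq ℂ]
      simp [inner_smul_left, inner_smul_right, horth, norm_smul, hn]
    have h6 : ‖R (e m) - R (e k)‖ < 1 := by simpa [dist_eq_norm] using h1
    nlinarith [norm_nonneg (R (e m) - R (e k))]
  have hfin' : {t : ℝ | t ≠ 0 ∧ |t| ≤ 1 ∧ S.eigenspace t ≠ ⊥}.Finite :=
    hfin.subset fun t ht => ht.2
  rcases Set.eq_empty_or_nonempty {t : ℝ | t ≠ 0 ∧ |t| ≤ 1 ∧ S.eigenspace t ≠ ⊥} with h0 | h0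
  · refine ⟨1, one_pos, fun t ht hb => ?_⟩
    by_contra hlt
    have : t ∈ {t : ℝ | t ≠ 0 ∧ |t| ≤ 1 ∧ S.eigenspace t ≠ ⊥} := ⟨ht, (not_le.1 hlt).le, hb⟩
    rw [h0] at this
    exact this
  · obtain ⟨t₀, ht₀, hmin⟩ := Set.exists_min_image _ (fun t : ℝ => |t|) hfin' h0
    refine ⟨|t₀|, abs_pos.2 ht₀.1, fun t ht hb => ?_⟩
    by_cases h1 : |t| ≤ 1
    · exact hmin t ⟨ht, h1, hb⟩
    · exact ht₀.2.1.trans (not_le.1 h1).le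

theorem norm_proj_smul_le {f : ℝ → ℝ} {C : ℝ} (hf : ∀ t, S.eigenspace t ≠ ⊥ → |f t| ≤ C)
    (x : H) (t : ℝ) : ‖(f t : ℂ) • S.proj t x‖ ^ 2 ≤ C ^ 2 * ‖S.proj t x‖ ^ 2 := by
  rw [norm_smul, Complex.norm_real, mul_pow]
  by_cases ht : S.eigenspace t = ⊥
  · have h0 : S.proj t x = 0 := by
      have := S.proj_mem t x
      rwa [ht, Submodule.mem_bot] at this
    simp [h0]
  · have := hf t ht
    gcongr
    exact this

theorem mem_domain_of_bounded {f : ℝ → ℝ} {C : ℝ} (hf : ∀ t, S.eigenspace t ≠ ⊥ → |f t| ≤ C)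
    (x : H) : x ∈ (S.spectralCalc f).domain :=
  Summable.of_nonneg_of_le (fun _ => sq_nonneg _) (S.norm_proj_smul_le hf x)
    ((S.summable_proj_sq x).mul_left _)

theorem norm_spectralCalc_le {f : ℝ → ℝ} {C : ℝ} (hf : ∀ t, S.eigenspace t ≠ ⊥ → |f t| ≤ C)
    (x : (S.spectralCalc f).domain) : ‖S.spectralCalc f x‖ ≤ |C| * ‖(x : H)‖ := by
  have hs : Summable fun t => (f t : ℂ) • S.proj t x := (S.summable_smul_proj_iff f x).2 x.2
  have hlim : Filter.Tendsto (fun s : Finset ℝ => ‖∑ t ∈ s, (f t : ℂ) • S.proj t x‖)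
      Filter.atTop (𝓝 ‖S.spectralCalc f x‖) := hs.hasSum.norm
  refine le_of_tendsto' hlim fun s => ?_
  have h1 : ‖∑ t ∈ s, (f t : ℂ) • S.proj t x‖ ^ 2 = ∑ t ∈ s, ‖(f t : ℂ) • S.proj t x‖ ^ 2 :=
    S.orthogonalFamily.norm_sum
      (fun t => ⟨(f t : ℂ) • S.proj t x, Submodule.smul_mem _ _ (S.proj_mem t x)⟩) s
  have h2 : ∑ t ∈ s, ‖(f t : ℂ) • S.proj t x‖ ^ 2 ≤ C ^ 2 * ‖(x : H)‖ ^ 2 := by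
    refine (Finset.sum_le_sum fun t _ => S.norm_proj_smul_le hf x t).trans ?_
    rw [← Finset.mul_sum]
    exact mul_le_mul_of_nonneg_left (S.bessel x s) (sq_nonneg C)
  refine (sq_le_sq₀ (by positivity) (by positivity)).1 ?_
  rw [h1, mul_pow, sq_abs]
  exact h2

theorem exists_bound_inv : ∃ C : ℝ, ∀ t, S.eigenspace t ≠ ⊥ → |(|t|⁻¹)| ≤ C := by
  obtain ⟨c, hc, h⟩ := S.spectral_gap
  refine ⟨c⁻¹, fun t ht => ?_⟩
  rw [abs_inv, abs_abs]
  by_cases h0 : t = 0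
  · rw [h0, abs_zero, inv_zero]
    positivity
  · exact inv_anti₀ hc (h t h0 ht)

/-- The bounded operator `ds = |D|⁻¹`, which is the inverse of `|D|` on the orthogonal complement
of `ker D` and is zero on `ker D` (recall that `0⁻¹ = 0`). -/
noncomputable def ds : H →L[ℂ] H :=
  LinearMap.mkContinuousOfExistsBound
    ((S.spectralCalc fun t => |t|⁻¹).toFun ∘ₗ
      LinearMap.codRestrict _ LinearMap.id fun x =>
        S.mem_domain_of_bounded S.exists_bound_inv.choose_spec x)
    ⟨_, fun x => S.norm_spectralCalc_le S.exists_bound_inv.choose_spec ⟨x, _⟩⟩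

end SpectralTriple

/-! ### The Dixmier trace -/

/-- The singular value `μ_k(T)` of a bounded operator, that is, its distance to the operators of
rank at most `k`. If `T` is positive and compact, this is the `k`-th eigenvalue (counted from
`k = 0`, with multiplicity) in decreasing order. -/
noncomputable def singularValue (T : H →L[ℂ] H) (k : ℕ) : ℝ :=
  ⨅ F : {F : H →L[ℂ] H // LinearMap.rank (F : H →ₗ[ℂ] H) ≤ k}, ‖T - F‖

/-- The generalized limits used to define Dixmier traces: positive linear forms on bounded
sequences which extend the limit and satisfy
`ω(α₀, α₀, α₁, α₁, …) = ω(α₀, α₁, …)`. -/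
structure DixmierLimit where
  toFun : BoundedContinuousFunction ℕ ℝ →ₗ[ℝ] ℝ
  nonneg : ∀ f : BoundedContinuousFunction ℕ ℝ, (∀ k, 0 ≤ f k) → 0 ≤ toFun f
  eq_lim : ∀ (f : BoundedContinuousFunction ℕ ℝ) (l : ℝ),
    Filter.Tendsto f Filter.atTop (𝓝 l) → toFun f = l
  dilation : ∀ f g : BoundedContinuousFunction ℕ ℝ,
    (∀ k, g (2 * k) = f k ∧ g (2 * k + 1) = f k) → toFun g = toFun f

/-- The sequence `N ↦ (log N)⁻¹ ∑_{k < N} μ_k(T)`. -/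
noncomputable def logMean (T : H →L[ℂ] H) (N : ℕ) : ℝ :=
  (∑ k ∈ Finset.range N, singularValue T k) / Real.log N

open Classical in
/-- The Dixmier trace of a positive operator `T` in the ideal of those operators for which
`∑_{k < N} μ_k(T) = O(log N)`. -/
noncomputable def dixmierPos (ω : DixmierLimit) (T : H →L[ℂ] H) : ℝ :=
  if h : ∃ C, ∀ N, ‖logMean T N‖ ≤ C then
    ω.toFun (BoundedContinuousFunction.ofNormedAddCommGroupDiscrete (logMean T) h.choose
      h.choose_spec)
  else 0

/-- The Dixmier trace, extended from positive operators by linearity: writing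
`T = (P₁ - P₂) + i (P₃ - P₄)` with the positive and negative parts of the real and imaginary
parts of `T`. -/
noncomputable def dixmierTrace (ω : DixmierLimit) (T : H →L[ℂ] H) : ℂ :=
  ((dixmierPos ω (ℜ T : H →L[ℂ] H)⁺ - dixmierPos ω (ℜ T : H →L[ℂ] H)⁻ : ℝ) : ℂ) +
    Complex.I *
      ((dixmierPos ω (ℑ T : H →L[ℂ] H)⁺ - dixmierPos ω (ℑ T : H →L[ℂ] H)⁻ : ℝ) : ℂ)

namespace SpectralTriple

variable (S : SpectralTriple A H)

/-- The spectral triple has dimension `n`: the decreasing sequence of eigenvalues of the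
positive compact operator `ds` is `O(k^(-1/n))`. -/
def HasDimension (n : ℕ) : Prop :=
  0 < n ∧ (fun k : ℕ => singularValue S.ds k) =O[Filter.atTop] fun k : ℕ => (k : ℝ) ^ (-(1 / n : ℝ))

/-- The algebra generated by `π(A)` and `[D, π(A)]`. -/
def diffAlgebra : Subalgebra ℂ (H →L[ℂ] H) :=
  Algebra.adjoin ℂ (Set.range S.rep ∪ Set.range S.comm)

/-- `b` lies in the domain of the `m`-th power of the derivation `b ↦ [|D|, b]`. -/
def InDomainPow : ℕ → (H →L[ℂ] H) → Prop
  | 0, _ => True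
  | m + 1, b => ∃ c : H →L[ℂ] H, IsCommutator S.absDirac b c ∧ InDomainPow m c

/-- Regularity: the algebra generated by `π(A)` and `[D, π(A)]` is smooth for `b ↦ [|D|, b]`. -/
def IsRegular : Prop := ∀ b ∈ S.diffAlgebra, ∀ m, S.InDomainPow m b

/-- The closedness condition for a three dimensional spectral triple. -/
def IsClosed (ω : DixmierLimit) : Prop :=
  ∀ a₁ a₂ a₃ : A, dixmierTrace ω (S.comm a₁ * S.comm a₂ * S.comm a₃ * S.ds ^ 3) = 0

/-- The noncommutative integral `⨍ T dsⁿ`; here `n / 2` in the exponent of `2` is the integer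
part. -/
noncomputable def integral (ω : DixmierLimit) (n : ℕ) (T : H →L[ℂ] H) : ℂ :=
  ((Real.pi ^ (n / 2 : ℝ) * Real.Gamma (n / 2 + 1) / 2 ^ (n - n / 2 : ℕ) : ℝ) : ℂ) *
    dixmierTrace ω (T * S.ds ^ n)

/-! ### Differential forms -/

/-- The representation `a₀ δa₁ ⋯ δa_k ↦ π(a₀) [D, π(a₁)] ⋯ [D, π(a_k)]` of `Ω(A)`. -/
noncomputable def formRep : UForm A →ₐ[ℂ] (H →L[ℂ] H) :=
  UForm.lift S.rep.toAlgHom S.comm S.comm_mul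

/-- The kernel of `π` on `Ω^k(A)`. -/
noncomputable def formKer (k : ℕ) : Submodule ℂ (UForm A) :=
  UForm.degree A k ⊓ LinearMap.ker S.formRep.toLinearMap

/-- `J = ker π + d (ker π)`, where `ker π` stands for the graded subspace
`⨁ₖ ker π ∩ Ω^k(A)`. -/
noncomputable def junk : Submodule ℂ (UForm A) :=
  ⨆ k, (S.formKer k ⊔ (S.formKer k).map UForm.d)

theorem mul_mem_formKer {p k : ℕ} {x y : UForm A} (hx : x ∈ UForm.degree A p)
    (hy : y ∈ S.formKer k) : x * y ∈ S.formKer (p + k) :=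
  ⟨UForm.mul_mem_degree hx hy.1, by
    have h : S.formRep y = 0 := hy.2
    change S.formRep (x * y) = 0
    rw [map_mul, h, mul_zero]⟩

theorem formKer_mul_mem {p k : ℕ} {x y : UForm A} (hx : x ∈ UForm.degree A p)
    (hy : y ∈ S.formKer k) : y * x ∈ S.formKer (k + p) :=
  ⟨UForm.mul_mem_degree hy.1 hx, by
    have h : S.formRep y = 0 := hy.2
    change S.formRep (y * x) = 0
    rw [map_mul, h, zero_mul]⟩

theorem formKer_le_junk {k : ℕ} {x : UForm A} (hx : x ∈ S.formKer k) : x ∈ S.junk :=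
  Submodule.mem_iSup_of_mem k (Submodule.mem_sup_left hx)

theorem d_formKer_le_junk {k : ℕ} {x : UForm A} (hx : x ∈ S.formKer k) :
    UForm.d x ∈ S.junk :=
  Submodule.mem_iSup_of_mem k (Submodule.mem_sup_right ⟨x, hx, rfl⟩)

theorem junk_induction {P : UForm A → Prop} (hk : ∀ k, ∀ x ∈ S.formKer k, P x)
    (hd : ∀ k, ∀ x ∈ S.formKer k, P (UForm.d x)) (hadd : ∀ x y, P x → P y → P (x + y))
    {x : UForm A} (hx : x ∈ S.junk) : P x := by
  refine Submodule.iSup_induction _ (motive := P) hx ?_ (hk 0 0 (zero_mem _)) hadd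
  intro k x hx
  obtain ⟨y, hy, z, ⟨w, hw, rfl⟩, rfl⟩ := Submodule.mem_sup.1 hx
  exact hadd _ _ (hk k y hy) (hd k w hw)

theorem mul_mem_junk (x : UForm A) {y : UForm A} (hy : y ∈ S.junk) :
    x * y ∈ S.junk ∧ y * x ∈ S.junk := by
  have hx : x ∈ ⨆ k, UForm.degree A k := by rw [UForm.iSup_degree]; trivial
  induction hx using Submodule.iSup_induction' with
  | zero => simp
  | add x x' _ _ h h' =>
    rw [add_mul, mul_add]
    exact ⟨add_mem h.1 h'.1, add_mem h.2 h'.2⟩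
  | mem p x hx =>
    have hsx : UForm.sgn x ∈ UForm.degree A p := by
      rw [UForm.sgn_of_mem hx]
      exact Submodule.smul_mem _ _ hx
    refine S.junk_induction (P := fun y => x * y ∈ S.junk ∧ y * x ∈ S.junk) ?_ ?_ ?_ hy
    · intro k y hy
      exact ⟨S.formKer_le_junk (S.mul_mem_formKer hx hy),
        S.formKer_le_junk (S.formKer_mul_mem hx hy)⟩
    · intro k y hy
      have h1 : x * UForm.d y = UForm.d (UForm.sgn x * y) - UForm.d (UForm.sgn x) * y := by
        rw [UForm.d_mul, UForm.sgn_sgn, add_sub_cancel_left]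
      have h2 : UForm.d y * x = UForm.d (y * x) - UForm.sgn y * UForm.d x := by
        rw [UForm.d_mul, add_sub_cancel_right]
      have hsy : UForm.sgn y ∈ S.formKer k := by
        rw [UForm.sgn_of_mem hy.1]
        exact Submodule.smul_mem _ _ hy
      rw [h1, h2]
      exact ⟨sub_mem (S.d_formKer_le_junk (S.mul_mem_formKer hsx hy))
          (S.formKer_le_junk (S.mul_mem_formKer (UForm.d_mem hsx) hy)),
        sub_mem (S.d_formKer_le_junk (S.formKer_mul_mem hx hy))
          (S.formKer_le_junk (S.formKer_mul_mem (UForm.d_mem hx) hsy))⟩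
    · rintro y z ⟨h1, h2⟩ ⟨h3, h4⟩
      rw [mul_add, add_mul]
      exact ⟨add_mem h1 h3, add_mem h2 h4⟩

theorem d_mem_junk {x : UForm A} (hx : x ∈ S.junk) : UForm.d x ∈ S.junk := by
  refine S.junk_induction (fun k y hy => S.d_formKer_le_junk hy) ?_ ?_ hx
  · intro k y _
    rw [UForm.d_d]
    exact zero_mem _
  · intro y z hy hz
    rw [map_add]
    exact add_mem hy hz

/-- `J` as a two-sided ideal of `Ω(A)`. -/
noncomputable def junkIdeal : Ideal (UForm A) where
  carrier := S.junk
  add_mem' := fun hx hy => add_mem hx hy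
  zero_mem' := zero_mem _
  smul_mem' := fun x _ hy => (S.mul_mem_junk x hy).1

instance : S.junkIdeal.IsTwoSided := ⟨fun x hy => (S.mul_mem_junk x hy).2⟩

/-- The algebra of differential forms `Ω_D(A) = Ω(A) / J`. In degree `k` it is
`π(Ω^k(A)) / π(d (ker π ∩ Ω^{k-1}(A)))`. -/
abbrev Form : Type _ := UForm A ⧸ S.junkIdeal

/-- The projection `Ω(A) → Ω_D(A)`. -/
noncomputable def toForm : UForm A →ₐ[ℂ] S.Form := Ideal.Quotient.mkₐ ℂ S.junkIdeal

/-- The exterior derivative of `Ω_D(A)`. -/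
noncomputable def dForm : S.Form →ₗ[ℂ] S.Form where
  toFun := Quotient.lift (fun x => S.toForm (UForm.d x)) (by
    intro x y h
    have h' : x - y ∈ S.junkIdeal := (Submodule.quotientRel_def _).1 h
    refine (Ideal.Quotient.eq (I := S.junkIdeal)).2 ?_
    rw [← map_sub]
    exact S.d_mem_junk h')
  map_add' := by
    rintro ⟨x⟩ ⟨y⟩
    change S.toForm (UForm.d (x + y)) = S.toForm (UForm.d x) + S.toForm (UForm.d y)
    rw [map_add, map_add]
  map_smul' := by
    rintro c ⟨x⟩
    change S.toForm (UForm.d (c • x)) = c • S.toForm (UForm.d x)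
    rw [map_smul, map_smul]

theorem dForm_toForm (x : UForm A) : S.dForm (S.toForm x) = S.toForm (UForm.d x) := rfl

/-- `Ω_D^k(A)`, the forms of degree `k`. -/
noncomputable def formDegree (k : ℕ) : Submodule ℂ S.Form :=
  (UForm.degree A k).map S.toForm.toLinearMap

theorem mul_mem_formDegree {p q : ℕ} {x y : S.Form} (hx : x ∈ S.formDegree p)
    (hy : y ∈ S.formDegree q) : x * y ∈ S.formDegree (p + q) := by
  obtain ⟨x, hx, rfl⟩ := hx
  obtain ⟨y, hy, rfl⟩ := hy
  exact ⟨x * y, UForm.mul_mem_degree hx hy, map_mul S.toForm x y⟩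

theorem dForm_mem {p : ℕ} {x : S.Form} (hx : x ∈ S.formDegree p) :
    S.dForm x ∈ S.formDegree (p + 1) := by
  obtain ⟨x, hx, rfl⟩ := hx
  exact ⟨UForm.d x, UForm.d_mem hx, rfl⟩

theorem toForm_incl_mem (a : A) : S.toForm (UForm.incl a) ∈ S.formDegree 0 :=
  ⟨_, UForm.incl_mem a, rfl⟩

theorem matrix_mul_mem {N p q : ℕ} {X Y : Matrix (Fin N) (Fin N) S.Form}
    (hX : ∀ i j, X i j ∈ S.formDegree p) (hY : ∀ i j, Y i j ∈ S.formDegree q) (i j : Fin N) :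
    (X * Y) i j ∈ S.formDegree (p + q) := by
  rw [Matrix.mul_apply]
  exact sum_mem fun k _ => S.mul_mem_formDegree (hX i k) (hY k j)

/-! ### The Chern-Simons action -/

variable {N : ℕ}

/-- `M_N(Ω_D¹(A))`, the matrices of 1-forms. -/
abbrev Potential (N : ℕ) : Type _ := Matrix (Fin N) (Fin N) (S.formDegree 1)

/-- A matrix of 1-forms is hermitian if its matrix of operators (1-forms are canonically
operators, as `π` is faithful on `A`) is hermitian. -/
def IsHermitian (V : S.Potential N) : Prop :=
  ∃ α : Matrix (Fin N) (Fin N) (UForm A), (∀ i j, α i j ∈ UForm.degree A 1) ∧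
    (∀ i j, S.toForm (α i j) = V i j) ∧ (α.map S.formRep).IsHermitian

/-- The Chern-Simons form `V dV + (2/3) V³` in `M_N(Ω_D(A))`. -/
noncomputable def csForm (V : S.Potential N) : Matrix (Fin N) (Fin N) S.Form :=
  let X : Matrix (Fin N) (Fin N) S.Form := V.map Subtype.val
  X * X.map S.dForm + (2 / 3 : ℂ) • X ^ 3

/-- The operator matrix `K` in `M_N(π(Ω³(A)))` is a representative of the Chern-Simons form. -/
def IsRepresentative (V : S.Potential N) (K : Matrix (Fin N) (Fin N) (H →L[ℂ] H)) : Prop :=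
  ∃ κ : Matrix (Fin N) (Fin N) (UForm A), (∀ i j, κ i j ∈ UForm.degree A 3) ∧
    κ.map S.toForm = S.csForm V ∧ κ.map S.formRep = K

theorem exists_representative (V : S.Potential N) : ∃ K, S.IsRepresentative V K := by
  have h1 : ∀ i j, (V.map Subtype.val : Matrix (Fin N) (Fin N) S.Form) i j ∈ S.formDegree 1 :=
    fun i j => (V i j).2
  have h : ∀ i j, S.csForm V i j ∈ S.formDegree 3 := by
    intro i j
    refine add_mem ?_ (Submodule.smul_mem _ _ ?_)
    · exact S.matrix_mul_mem h1 (fun i j => S.dForm_mem (h1 i j)) i j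
    · rw [pow_three]
      exact S.matrix_mul_mem h1 (S.matrix_mul_mem h1 h1) i j
  choose κ hκ e using h
  exact ⟨_, Matrix.of κ, hκ, Matrix.ext e, rfl⟩

/-- The Chern-Simons action `S_CS[V] = ⨍ tr(K) ds³`, for a representative `K` of the Chern-Simons
form of `V`. -/
noncomputable def csAction (ω : DixmierLimit) (V : S.Potential N) : ℂ :=
  S.integral ω 3 (S.exists_representative V).choose.trace

/-- The gauge transform `u V u⁻¹ + u du⁻¹`. -/
noncomputable def gaugeTransform (u : unitary (Matrix (Fin N) (Fin N) A)) (V : S.Potential N) :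
    S.Potential N :=
  let ι : A → S.Form := fun a => S.toForm (UForm.incl a)
  let U : Matrix (Fin N) (Fin N) S.Form := (u : Matrix (Fin N) (Fin N) A).map ι
  let U' : Matrix (Fin N) (Fin N) S.Form := (u⁻¹ : unitary (Matrix (Fin N) (Fin N) A)).1.map ι
  Matrix.of fun i j => ⟨(U * V.map Subtype.val * U' + U * U'.map S.dForm) i j, by
    have hU : ∀ i j, U i j ∈ S.formDegree 0 := fun i j => S.toForm_incl_mem _
    have hU' : ∀ i j, U' i j ∈ S.formDegree 0 := fun i j => S.toForm_incl_mem _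
    have hV : ∀ i j, (V.map Subtype.val : Matrix (Fin N) (Fin N) S.Form) i j ∈ S.formDegree 1 :=
      fun i j => (V i j).2
    exact add_mem (S.matrix_mul_mem (S.matrix_mul_mem hU hV) hU' i j)
      (S.matrix_mul_mem hU (fun i j => S.dForm_mem (hU' i j)) i j)⟩

/-- `Γ[u] = -(1/3) ⨍ tr((u du⁻¹)³) ds³`, where `du⁻¹ = [D, π(u⁻¹)]`. -/
noncomputable def gaugeAnomaly (ω : DixmierLimit) (u : unitary (Matrix (Fin N) (Fin N) A)) : ℂ :=
  -(1 / 3) * S.integral ω 3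
    (((u : Matrix (Fin N) (Fin N) A).map S.rep *
      (u⁻¹ : unitary (Matrix (Fin N) (Fin N) A)).1.map S.comm) ^ 3).trace

end SpectralTriple

end Triple

end NCCS

/-!
The proof has an analytic half and an algebraic half.

**Analysis.** The functional `T ↦ ⨍ T ds³` is linear on bounded operators, and it satisfies
`⨍ b T ds³ = ⨍ T b ds³` whenever `b` lies in the algebra generated by `π(A)` and `[D, π(A)]`
(`HasDimension.integral_mul_comm`). Additivity of the Dixmier trace on positive operators
(`dixmierPos_add`) comes from the two Ky Fan inequalities
`∑_{k<N} μ_k(a+b) ≤ ∑_{k<N} μ_k(a) + ∑_{k<N} μ_k(b) ≤ ∑_{k<2N} μ_k(a+b)`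
together with `μ_k = O(1/k)`, which makes the gap between the two outer sums bounded and hence
negligible after division by `log N`. The Ky Fan inequalities follow from a variational
description of `∑_{k<N} μ_k(a)` as the supremum of the traces of compressions of `a` to
subspaces of dimension at most `N` (`compressionTrace_le`, `exists_orthonormal_sum_inner_ge`).
Linearity and unitary invariance give `Tr_ω(b T) = Tr_ω(T b)`, as bounded operators are spanned
by unitaries. Finally `[b, ds] = ds [|D|, b] ds` up to finite rank (`commutator_ds`; this uses that
the eigenvectors of `D` span a dense subspace), so regularity gives `μ_k([b, ds³]) = O(k^(-4/3))`,
which is trace class and invisible to `Tr_ω`.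

**Algebra.** Consequently `τ(x) = ⨍ tr(π(x)) ds³` is a trace on `M_N(Ω(A))`, and by the closedness
hypothesis it vanishes on `d(M_N(Ω²(A)))`. As `J ∩ Ω³ = (ker π ∩ Ω³) + d(ker π ∩ Ω²)`, it
vanishes on `J ∩ Ω³`, so the action does not depend on the representative. For the gauge variation
put `θ = u du⁻¹` and `β = u α u⁻¹`. Then `dθ = -θ²` and `d(β + θ) = u dα u⁻¹ - θβ - βθ - θ²`;
expanding the Chern-Simons form of `β + θ` under the trace, all mixed terms cancel except
`τ(θ u dα u⁻¹) - τ(θ² β)`, which vanishes because `τ(d(θβ)) = 0`, and what remains is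
`τ(α dα + (2/3) α³) - (1/3) τ(θ³)` (`trace_chernSimons_gauge`). Hermiticity is preserved because
`[D, π(a)]* = -[D, π(a*)]`.
-/

namespace NCCS

/-! ### Singular values -/

section SingularValues

variable {H : Type*} [NormedAddCommGroup H] [InnerProductSpace ℂ H]

theorem singularValue_bddBelow (T : H →L[ℂ] H) (k : ℕ) :
    BddBelow (Set.range fun F : {F : H →L[ℂ] H // LinearMap.rank (F : H →ₗ[ℂ] H) ≤ k} =>
      ‖T - F‖) :=
  ⟨0, by rintro _ ⟨F, rfl⟩; exact norm_nonneg _⟩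

theorem singularValue_le (T : H →L[ℂ] H) {k : ℕ} (F : H →L[ℂ] H)
    (hF : LinearMap.rank (F : H →ₗ[ℂ] H) ≤ k) : singularValue T k ≤ ‖T - F‖ :=
  ciInf_le (singularValue_bddBelow T k) ⟨F, hF⟩

theorem le_singularValue {T : H →L[ℂ] H} {k : ℕ} {c : ℝ}
    (h : ∀ F : H →L[ℂ] H, LinearMap.rank (F : H →ₗ[ℂ] H) ≤ k → c ≤ ‖T - F‖) :
    c ≤ singularValue T k :=
  have : Nonempty {F : H →L[ℂ] H // LinearMap.rank (F : H →ₗ[ℂ] H) ≤ k} :=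
    ⟨⟨0, by simp⟩⟩
  le_ciInf fun F => h F.1 F.2

theorem singularValue_nonneg (T : H →L[ℂ] H) (k : ℕ) : 0 ≤ singularValue T k :=
  le_singularValue fun _ _ => norm_nonneg _

theorem singularValue_le_norm (T : H →L[ℂ] H) (k : ℕ) : singularValue T k ≤ ‖T‖ := by
  simpa using singularValue_le T (k := k) 0 (by simp)

theorem singularValue_antitone (T : H →L[ℂ] H) : Antitone (singularValue T) := fun j k hjk =>
  le_singularValue fun F hF => singularValue_le T F (hF.trans (by exact_mod_cast hjk))

theorem singularValue_eq_zero {T : H →L[ℂ] H} {k : ℕ} (h : LinearMap.rank (T : H →ₗ[ℂ] H) ≤ k) :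
    singularValue T k = 0 :=
  le_antisymm (by simpa using singularValue_le T T h) (singularValue_nonneg T k)

theorem singularValue_add_le (S T : H →L[ℂ] H) (j k : ℕ) :
    singularValue (S + T) (j + k) ≤ singularValue S j + singularValue T k := by
  rw [← sub_le_iff_le_add]
  refine le_singularValue fun F hF => ?_
  rw [sub_le_iff_le_add, ← sub_le_iff_le_add']
  refine le_singularValue fun G hG => ?_
  rw [sub_le_iff_le_add']
  calc singularValue (S + T) (j + k) ≤ ‖S + T - (F + G)‖ := by
        refine singularValue_le _ _ ?_
        rw [ContinuousLinearMap.toLinearMap_add]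
        push_cast
        exact (LinearMap.rank_add_le _ _).trans (add_le_add hF hG)
    _ ≤ ‖S - F‖ + ‖T - G‖ := by
        rw [add_sub_add_comm]
        exact norm_add_le _ _
    _ = _ := by ring

/-- From `S T - (F T + (S - F) G) = (S - F) (T - G)`. -/
theorem singularValue_mul_le (S T : H →L[ℂ] H) (j k : ℕ) :
    singularValue (S * T) (j + k) ≤ singularValue S j * singularValue T k := by
  have key : ∀ F G : H →L[ℂ] H, LinearMap.rank (F : H →ₗ[ℂ] H) ≤ j →
      LinearMap.rank (G : H →ₗ[ℂ] H) ≤ k →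
      singularValue (S * T) (j + k) ≤ ‖S - F‖ * ‖T - G‖ := by
    intro F G hF hG
    refine (singularValue_le _ (F * T + (S - F) * G) ?_).trans ?_
    · rw [ContinuousLinearMap.toLinearMap_add]
      push_cast
      exact (LinearMap.rank_add_le _ _).trans
        (add_le_add ((LinearMap.rank_comp_le_left _ _).trans hF)
          ((LinearMap.rank_comp_le_right _ _).trans hG))
    · rw [show S * T - (F * T + (S - F) * G) = (S - F) * (T - G) by noncomm_ring]
      exact norm_mul_le _ _
  have h1 : ∀ F : H →L[ℂ] H, LinearMap.rank (F : H →ₗ[ℂ] H) ≤ j →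
      singularValue (S * T) (j + k) ≤ ‖S - F‖ * singularValue T k := by
    intro F hF
    rcases (norm_nonneg (S - F)).eq_or_lt with h0 | h0
    · have := key F 0 hF (by simp)
      rw [← h0, zero_mul] at this ⊢
      exact this
    · rw [← div_le_iff₀' h0]
      refine le_singularValue fun G hG => ?_
      rw [div_le_iff₀' h0]
      exact key F G hF hG
  rcases (singularValue_nonneg T k).eq_or_lt with h0 | h0
  · have := h1 0 (by simp)
    rw [← h0, mul_zero] at this ⊢
    exact this
  · rw [← div_le_iff₀ h0]
    refine le_singularValue fun F hF => ?_
    rw [div_le_iff₀ h0]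
    exact h1 F hF

theorem singularValue_mul_le_left (S T : H →L[ℂ] H) (k : ℕ) :
    singularValue (S * T) k ≤ ‖S‖ * singularValue T k := by
  have h := singularValue_mul_le S T 0 k
  rw [zero_add] at h
  exact h.trans (mul_le_mul_of_nonneg_right (singularValue_le_norm S 0) (singularValue_nonneg T k))

theorem singularValue_mul_le_right (S T : H →L[ℂ] H) (k : ℕ) :
    singularValue (S * T) k ≤ singularValue S k * ‖T‖ :=
  (singularValue_mul_le S T k 0).trans
    (mul_le_mul_of_nonneg_left (singularValue_le_norm T 0) (singularValue_nonneg S k))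

theorem singularValue_smul (c : ℂ) (T : H →L[ℂ] H) (k : ℕ) :
    singularValue (c • T) k = ‖c‖ * singularValue T k := by
  have h : ∀ (c : ℂ) (T : H →L[ℂ] H), singularValue (c • T) k ≤ ‖c‖ * singularValue T k := by
    intro c T
    have h1 := singularValue_mul_le_left (c • (1 : H →L[ℂ] H)) T k
    rw [smul_mul_assoc, one_mul] at h1
    refine h1.trans (mul_le_mul_of_nonneg_right ?_ (singularValue_nonneg T k))
    rw [norm_smul]
    exact mul_le_of_le_one_right (norm_nonneg c) ContinuousLinearMap.norm_id_le
  refine le_antisymm (h c T) ?_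
  rcases eq_or_ne c 0 with rfl | hc
  · simpa using singularValue_nonneg _ k
  · have h2 := h c⁻¹ (c • T)
    rw [inv_smul_smul₀ hc, norm_inv] at h2
    rwa [← le_inv_mul_iff₀ (norm_pos_iff.2 hc)]

variable [CompleteSpace H]

/-- If `P` is the projection onto the range of `F`, then `F* = F* P`. -/
theorem rank_star_le (F : H →L[ℂ] H) {k : ℕ} (hF : LinearMap.rank (F : H →ₗ[ℂ] H) ≤ k) :
    LinearMap.rank ((star F : H →L[ℂ] H) : H →ₗ[ℂ] H) ≤ k := by
  let E := LinearMap.range (F : H →ₗ[ℂ] H)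
  have : FiniteDimensional ℂ E :=
    Module.rank_lt_aleph0_iff.1 (lt_of_le_of_lt hF (Cardinal.natCast_lt_aleph0))
  have h1 : E.starProjection * F = F := by
    ext x
    exact Submodule.starProjection_eq_self_iff.2 ⟨x, rfl⟩
  have h2 : star F = star F * E.starProjection := by
    conv_lhs => rw [← h1, star_mul]
    congr 1
    exact (isSelfAdjoint_starProjection E)
  rw [h2]
  refine (LinearMap.rank_comp_le_right _ _).trans (le_trans ?_ hF)
  exact Submodule.rank_mono (by
    rintro _ ⟨x, rfl⟩
    exact Submodule.starProjection_apply_mem E x)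

theorem singularValue_star (T : H →L[ℂ] H) (k : ℕ) :
    singularValue (star T) k = singularValue T k := by
  have h : ∀ T : H →L[ℂ] H, singularValue (star T) k ≤ singularValue T k := fun T =>
    le_singularValue fun F hF => by
      have := singularValue_le (star T) (star F) (rank_star_le F hF)
      rwa [← star_sub, norm_star] at this
  refine le_antisymm (h T) ?_
  simpa using h (star T)

/-- The projection onto the orthogonal complement of the kernel of an operator of rank at most `k`
has rank at most `k`. -/
theorem rank_starProjection_ker_orthogonal (F : H →L[ℂ] H) {k : ℕ}
    (hF : LinearMap.rank (F : H →ₗ[ℂ] H) ≤ k) :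
    LinearMap.rank (((F.kerᗮ).starProjection : H →L[ℂ] H) : H →ₗ[ℂ] H) ≤ k := by
  refine le_trans ?_ hF
  let g : (F.kerᗮ : Submodule ℂ H) →ₗ[ℂ] LinearMap.range (F : H →ₗ[ℂ] H) :=
    (F : H →ₗ[ℂ] H).rangeRestrict ∘ₗ (F.kerᗮ).subtype
  have hg : Function.Injective g := by
    rw [injective_iff_map_eq_zero]
    rintro ⟨x, hx⟩ h
    have h1 : F x = 0 := congrArg Subtype.val h
    have h2 : x ∈ F.ker := h1
    have h3 : inner ℂ x x = 0 := hx x h2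
    exact Subtype.ext (inner_self_eq_zero.1 h3)
  have h4 : LinearMap.range (((F.kerᗮ).starProjection : H →L[ℂ] H) : H →ₗ[ℂ] H) ≤ F.kerᗮ := by
    rintro _ ⟨x, rfl⟩
    exact Submodule.starProjection_apply_mem _ x
  exact (Submodule.rank_mono h4).trans (LinearMap.rank_le_of_injective g hg)

/-- Singular values only depend on the function `x ↦ ‖T x‖`, monotonically: an operator `F` of rank
at most `k` agrees with `0` on `ker F`, and `S` may be cut down to `ker F` at the cost of an operator
of rank at most `k`. -/
theorem singularValue_le_of_norm_apply_le {S T : H →L[ℂ] H} (h : ∀ x, ‖S x‖ ≤ ‖T x‖) (k : ℕ) :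
    singularValue S k ≤ singularValue T k := by
  refine le_singularValue fun F hF => ?_
  have : CompleteSpace F.ker := F.isClosed_ker.completeSpace_coe
  refine (singularValue_le S (S * (F.kerᗮ).starProjection) ?_).trans ?_
  · exact (LinearMap.rank_comp_le_right _ _).trans (rank_starProjection_ker_orthogonal F hF)
  · refine ContinuousLinearMap.opNorm_le_bound _ (norm_nonneg _) fun x => ?_
    have hx : (S - S * (F.kerᗮ).starProjection) x = S (F.ker.starProjection x) := by
      change S x - S ((F.kerᗮ).starProjection x) = _
      rw [← map_sub]
      congr 1
      rw [Submodule.starProjection_orthogonal_val]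
      abel
    have h0 : F (F.ker.starProjection x) = 0 := Submodule.starProjection_apply_mem F.ker x
    rw [hx]
    refine (h _).trans ?_
    have h1 : T (F.ker.starProjection x) = (T - F) (F.ker.starProjection x) := by
      change _ = T _ - F _
      rw [h0, sub_zero]
    rw [h1]
    refine ((T - F).le_opNorm _).trans (mul_le_mul_of_nonneg_left ?_ (norm_nonneg _))
    exact Submodule.norm_starProjection_apply_le _ x

end SingularValues

/-! ### The Ky Fan inequalities -/

section KyFan

variable {H : Type*} [NormedAddCommGroup H] [InnerProductSpace ℂ H]

/-- The trace of the compression of `a` to the finite-dimensional subspace `E` (real part). -/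
noncomputable def compressionTrace (a : H →L[ℂ] H) (E : Submodule ℂ H) [FiniteDimensional ℂ E] :
    ℝ :=
  (LinearMap.trace ℂ E (E.orthogonalProjectionOnto ∘L a ∘L E.subtypeL : E →L[ℂ] E)).re

theorem compressionTrace_eq_sum (a : H →L[ℂ] H) (E : Submodule ℂ H) [FiniteDimensional ℂ E]
    {ι : Type*} [Fintype ι] (b : OrthonormalBasis ι ℂ E) :
    compressionTrace a E = ∑ i, (inner ℂ (b i : H) (a (b i))).re := by
  rw [compressionTrace, LinearMap.trace_eq_sum_inner _ b, Complex.re_sum]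
  refine Finset.sum_congr rfl fun i _ => ?_
  congr 1
  exact Submodule.inner_orthogonalProjectionOnto_eq_of_mem_left (b i) (a (b i))

theorem compressionTrace_add (a b : H →L[ℂ] H) (E : Submodule ℂ H) [FiniteDimensional ℂ E] :
    compressionTrace (a + b) E = compressionTrace a E + compressionTrace b E := by
  simp only [compressionTrace_eq_sum _ E (stdOrthonormalBasis ℂ E), ← Finset.sum_add_distrib]
  refine Finset.sum_congr rfl fun i _ => ?_
  rw [add_apply, inner_add_right, Complex.add_re]

open Classical in
/-- An orthonormal set in `E` can be completed to an orthonormal basis of `E`. -/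
theorem sum_inner_le_compressionTrace {a : H →L[ℂ] H} (ha : ∀ x, 0 ≤ (inner ℂ x (a x)).re)
    (E : Submodule ℂ H) [FiniteDimensional ℂ E] (s : Finset H) (hs : ∀ x ∈ s, x ∈ E)
    (ho : ∀ x ∈ s, ∀ y ∈ s, inner ℂ x y = if x = y then (1 : ℂ) else 0) :
    ∑ x ∈ s, (inner ℂ x (a x)).re ≤ compressionTrace a E := by
  have hv : Orthonormal ℂ (Subtype.val : {x : E | (x : H) ∈ s} → E) := by
    rw [orthonormal_subtype_iff_ite]
    intro x hx y hy
    have := ho x hx y hy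
    rw [Submodule.coe_inner, this]
    simp only [Subtype.ext_iff]
  obtain ⟨u, b, hu, hb⟩ := hv.exists_orthonormalBasis_extension
  have h1 : compressionTrace a E = ∑ x ∈ u.map (Function.Embedding.subtype _),
      (inner ℂ x (a x)).re := by
    rw [compressionTrace_eq_sum a E b, hb, Finset.sum_map]
    exact Finset.sum_coe_sort u fun x : E => (inner ℂ (x : H) (a x)).re
  rw [h1]
  refine Finset.sum_le_sum_of_subset_of_nonneg ?_ fun x _ _ => ha x
  intro x hx
  exact Finset.mem_map.2 ⟨⟨x, hs x hx⟩, hu hx, rfl⟩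

/-- Courant–Fischer: the trace of a compression to an `n`-dimensional space is at most the sum of
the first `n` singular values. Indeed an operator of rank at most `i` kills a nonzero combination
of the top `i + 1` eigenvectors of the compression. -/
theorem compressionTrace_le {a : H →L[ℂ] H} (ha : a.IsSymmetric)
    (E : Submodule ℂ H) [FiniteDimensional ℂ E] :
    compressionTrace a E ≤ ∑ k ∈ Finset.range (Module.finrank ℂ E), singularValue a k := by
  let T : E →ₗ[ℂ] E := (E.orthogonalProjectionOnto ∘L a ∘L E.subtypeL : E →L[ℂ] E)
  have hin : ∀ x y : E, inner ℂ x (T y) = inner ℂ (x : H) (a y) := fun x y =>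
    Submodule.inner_orthogonalProjectionOnto_eq_of_mem_left x (a y)
  have hT : T.IsSymmetric := by
    intro x y
    rw [hin, ← inner_conj_symm, hin, inner_conj_symm]
    exact ha x y
  let e := hT.eigenvectorBasis rfl
  let l := hT.eigenvalues rfl
  have hTe : ∀ i, T (e i) = (l i : ℂ) • e i := hT.apply_eigenvectorBasis rfl
  have h1 : compressionTrace a E = ∑ i, l i := by
    rw [compressionTrace_eq_sum a E e]
    refine Finset.sum_congr rfl fun i _ => ?_
    rw [← hin, hTe, inner_smul_right, inner_self_eq_norm_sq_to_K, e.norm_eq_one]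
    simp
  rw [h1, Finset.sum_range]
  refine Finset.sum_le_sum fun i _ => le_singularValue fun F hF => ?_
  have hfin : FiniteDimensional ℂ (LinearMap.range (F : H →ₗ[ℂ] H)) :=
    Module.rank_lt_aleph0_iff.1 (lt_of_le_of_lt hF (Cardinal.natCast_lt_aleph0))
  let emb : Fin (i + 1) → Fin (Module.finrank ℂ E) := Fin.castLE i.2
  let f : (Fin (i + 1) → ℂ) →ₗ[ℂ] E := Fintype.linearCombination ℂ fun j => e (emb j)
  let g : (Fin (i + 1) → ℂ) →ₗ[ℂ] LinearMap.range (F : H →ₗ[ℂ] H) :=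
    (F : H →ₗ[ℂ] H).rangeRestrict ∘ₗ E.subtype ∘ₗ f
  have hker : LinearMap.ker g ≠ ⊥ := by
    refine LinearMap.ker_ne_bot_of_finrank_lt ?_
    rw [Module.finrank_fin_fun]
    exact Nat.lt_succ_of_le (Module.finrank_le_of_rank_le hF)
  obtain ⟨c, hc, hc0⟩ := Submodule.exists_mem_ne_zero_of_ne_bot hker
  have hF0 : F (f c) = 0 := congrArg Subtype.val (show g c = 0 from hc)
  have hemb : Function.Injective emb := Fin.castLE_injective i.2
  have ho : Orthonormal ℂ fun j => e (emb j) := e.orthonormal.comp emb hemb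
  have hfc : f c = ∑ j, c j • e (emb j) := Fintype.linearCombination_apply _ _ _
  have hTf : T (f c) = ∑ j, (c j * l (emb j)) • e (emb j) := by
    rw [hfc, map_sum]
    refine Finset.sum_congr rfl fun j _ => ?_
    rw [map_smul, hTe, smul_smul]
  have hq : (inner ℂ (f c : H) (a (f c))).re = ∑ j, ‖c j‖ ^ 2 * l (emb j) := by
    rw [← hin, hTf, hfc, ho.inner_sum, Complex.re_sum]
    refine Finset.sum_congr rfl fun j _ => ?_
    rw [← mul_assoc, ← Complex.normSq_eq_conj_mul_self, Complex.normSq_eq_norm_sq]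
    norm_cast
  have hn : ‖(f c : H)‖ ^ 2 = ∑ j, ‖c j‖ ^ 2 := by
    have h : inner ℂ (f c) (f c) = ∑ j, starRingEnd ℂ (c j) * c j := by
      rw [hfc, ho.inner_sum]
    rw [inner_self_eq_norm_sq_to_K] at h
    have h' := congrArg Complex.re h
    rw [Complex.re_sum] at h'
    simp only [← Complex.normSq_eq_conj_mul_self, Complex.normSq_eq_norm_sq, Complex.ofReal_re] at h'
    rw [← h']
    norm_cast
  have hpos : 0 < ‖(f c : H)‖ ^ 2 := by
    rw [hn]
    obtain ⟨j, hj⟩ := Function.ne_iff.1 hc0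
    refine Finset.sum_pos' (fun _ _ => by positivity) ⟨j, Finset.mem_univ j, ?_⟩
    have : 0 < ‖c j‖ := norm_pos_iff.2 hj
    positivity
  have h2 : l i * ‖(f c : H)‖ ^ 2 ≤ (inner ℂ (f c : H) (a (f c))).re := by
    rw [hq, hn, Finset.mul_sum]
    refine Finset.sum_le_sum fun j _ => ?_
    rw [mul_comm]
    refine mul_le_mul_of_nonneg_left ?_ (by positivity)
    refine hT.eigenvalues_antitone rfl ?_
    exact Nat.lt_succ_iff.1 j.2
  have h3 : (inner ℂ (f c : H) (a (f c))).re ≤ ‖a - F‖ * ‖(f c : H)‖ ^ 2 := by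
    have h4 : a (f c) = (a - F) (f c) := by
      rw [sub_apply, hF0, sub_zero]
    rw [h4]
    refine (Complex.re_le_norm _).trans ((norm_inner_le_norm _ _).trans ?_)
    calc ‖(f c : H)‖ * ‖(a - F) (f c)‖ ≤ ‖(f c : H)‖ * (‖a - F‖ * ‖(f c : H)‖) := by
          gcongr
          exact (a - F).le_opNorm _
      _ = _ := by ring
  exact le_of_mul_le_mul_right (h2.trans h3) hpos

theorem compressionTrace_le_of_finrank_le {a : H →L[ℂ] H} (ha : a.IsSymmetric)
    (E : Submodule ℂ H) [FiniteDimensional ℂ E] {N : ℕ} (hN : Module.finrank ℂ E ≤ N) :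
    compressionTrace a E ≤ ∑ k ∈ Finset.range N, singularValue a k :=
  (compressionTrace_le ha E).trans <|
    Finset.sum_le_sum_of_subset_of_nonneg (Finset.range_mono hN)
      fun k _ _ => singularValue_nonneg a k

theorem re_inner_nonneg_of_nonneg {a : H →L[ℂ] H} (ha : 0 ≤ a) (x : H) :
    0 ≤ (inner ℂ x (a x)).re :=
  ((ContinuousLinearMap.nonneg_iff_isPositive a).1 ha).re_inner_nonneg_right x

theorem isSymmetric_of_nonneg {a : H →L[ℂ] H} (ha : 0 ≤ a) : a.IsSymmetric :=
  ((ContinuousLinearMap.nonneg_iff_isPositive a).1 ha).isSymmetric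

variable [CompleteSpace H]

open Classical in
/-- For a positive operator `a`, orthonormal systems of at most `N` vectors approximate
`∑_{k < N} μ_k(a)` by the sums of their diagonal matrix coefficients. The vectors are chosen
greedily: if no unit vector orthogonal to the previous ones has a coefficient of at least
`μ_N(a) - ε`, then `√a (1 - P) √a`, with `P` the projection onto their span, is an approximation of
`a` up to rank `N` of norm less than `μ_N(a)`. -/
theorem exists_orthonormal_sum_inner_ge {a : H →L[ℂ] H} (ha : 0 ≤ a) {ε : ℝ} (hε : 0 < ε) (N : ℕ) :
    ∃ s : Finset H, s.card ≤ N ∧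
      (∀ x ∈ s, ∀ y ∈ s, inner ℂ x y = if x = y then (1 : ℂ) else 0) ∧
      ∑ k ∈ Finset.range N, singularValue a k - N * ε ≤ ∑ x ∈ s, (inner ℂ x (a x)).re := by
  induction N with
  | zero => exact ⟨∅, by simp⟩
  | succ N ih =>
    obtain ⟨s, hs, ho, hsum⟩ := ih
    let E : Submodule ℂ H := Submodule.span ℂ (s : Set H)
    have hEfin : FiniteDimensional ℂ E := FiniteDimensional.span_finset ℂ s
    by_cases hx : ∃ x ∈ Eᗮ, ‖x‖ = 1 ∧ singularValue a N - ε ≤ (inner ℂ x (a x)).re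
    · obtain ⟨x, hxE, hx1, hxa⟩ := hx
      have hxx : inner ℂ x x = (1 : ℂ) := by
        rw [inner_self_eq_norm_sq_to_K, hx1]; simp
      have hxs : ∀ y ∈ s, inner ℂ y x = (0 : ℂ) := fun y hy => hxE y (Submodule.subset_span hy)
      have hxs' : ∀ y ∈ s, inner ℂ x y = (0 : ℂ) := fun y hy => inner_eq_zero_symm.1 (hxs y hy)
      have hxn : x ∉ s := fun h => by
        have := hxs x h
        rw [hxx] at this
        exact one_ne_zero this
      refine ⟨insert x s, ?_, ?_, ?_⟩
      · rw [Finset.card_insert_of_notMem hxn]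
        omega
      · intro y hy z hz
        rw [Finset.mem_insert] at hy hz
        rcases hy with rfl | hy <;> rcases hz with rfl | hz
        · rw [hxx, if_pos rfl]
        · rw [hxs' z hz, if_neg (by rintro rfl; exact hxn hz)]
        · rw [hxs y hy, if_neg (by rintro rfl; exact hxn hy)]
        · exact ho y hy z hz
      · rw [Finset.sum_insert hxn, Finset.sum_range_succ]
        push_cast
        linarith
    · push Not at hx
      refine ⟨s, hs.trans (Nat.le_succ N), ho, ?_⟩
      suffices h : singularValue a N ≤ ε by
        rw [Finset.sum_range_succ]
        push_cast
        linarith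
      by_contra! hm
      let c := CFC.sqrt a
      have hcc : c * c = a := CFC.sqrt_mul_sqrt_self a ha
      have hcs : star c = c := (IsSelfAdjoint.of_nonneg (CFC.sqrt_nonneg a)).star_eq
      let P := Eᗮ.starProjection
      have hP : star P = P := (isSelfAdjoint_starProjection Eᗮ).star_eq
      have hPP : P * P = P := Eᗮ.isIdempotentElem_starProjection
      set m := singularValue a N - ε with hmdef
      have hm0 : 0 < m := by linarith
      -- the quadratic form of `a` is at most `m` on `Eᗮ`
      have h1 : ∀ x ∈ Eᗮ, (inner ℂ x (a x)).re ≤ m * ‖x‖ ^ 2 := by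
        intro x hxE
        rcases eq_or_ne x 0 with rfl | h0
        · simp
        · have hn : 0 < ‖x‖ := norm_pos_iff.2 h0
          have := hx ((‖x‖⁻¹ : ℂ) • x) (Submodule.smul_mem _ _ hxE) (by
            rw [norm_smul, norm_inv, Complex.norm_real, norm_norm, inv_mul_cancel₀ hn.ne'])
          rw [map_smul, inner_smul_left, inner_smul_right, ← mul_assoc, map_inv₀,
            Complex.conj_ofReal, ← mul_inv, ← Complex.ofReal_mul, ← Complex.ofReal_inv,
            Complex.re_ofReal_mul, inv_mul_lt_iff₀ (by positivity)] at this
          nlinarith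
      have h2 : ‖c * P‖ ≤ Real.sqrt m := by
        refine ContinuousLinearMap.opNorm_le_bound _ (Real.sqrt_nonneg _) fun x => ?_
        refine (sq_le_sq₀ (norm_nonneg _) (by positivity)).1 ?_
        rw [mul_pow, Real.sq_sqrt hm0.le]
        have h3 : ‖(c * P) x‖ ^ 2 = (inner ℂ (P x) (a (P x))).re := by
          have : inner ℂ (c (P x)) (c (P x)) = inner ℂ (P x) (a (P x)) := by
            rw [← hcc]
            conv_lhs => rw [← ContinuousLinearMap.adjoint_inner_right,
              ← ContinuousLinearMap.star_eq_adjoint, hcs]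
            rfl
          rw [← this, inner_self_eq_norm_sq_to_K]
          norm_cast
        rw [h3]
        refine (h1 _ (Submodule.starProjection_apply_mem _ x)).trans ?_
        gcongr
        exact Submodule.norm_starProjection_apply_le _ x
      have h3 : singularValue a N ≤ ‖a - c * E.starProjection * c‖ := by
        refine singularValue_le a _ ?_
        refine (LinearMap.rank_comp_le_left _ _).trans
          ((LinearMap.rank_comp_le_right _ _).trans ?_)
        have h4 : LinearMap.range ((E.starProjection : H →L[ℂ] H) : H →ₗ[ℂ] H) ≤ E := by
          rintro _ ⟨x, rfl⟩
          exact Submodule.starProjection_apply_mem _ x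
        refine (Submodule.rank_mono h4).trans ((rank_span_finset_le s).trans ?_)
        exact_mod_cast hs
      have h4 : a - c * E.starProjection * c = (c * P) * star (c * P) := by
        have h5 : P = 1 - E.starProjection := Submodule.starProjection_orthogonal E
        rw [star_mul, hP, hcs, mul_assoc c P, ← mul_assoc P P, hPP, h5, ← hcc]
        noncomm_ring
      have h5 : ‖(c * P) * star (c * P)‖ ≤ m := by
        refine (norm_mul_le _ _).trans ?_
        rw [norm_star]
        calc ‖c * P‖ * ‖c * P‖ ≤ Real.sqrt m * Real.sqrt m := by gcongr
          _ = m := Real.mul_self_sqrt hm0.le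
      rw [h4] at h3
      linarith

theorem sum_singularValue_add_le {a b : H →L[ℂ] H} (ha : 0 ≤ a) (hb : 0 ≤ b) (N : ℕ) :
    ∑ k ∈ Finset.range N, singularValue (a + b) k ≤
      ∑ k ∈ Finset.range N, singularValue a k + ∑ k ∈ Finset.range N, singularValue b k := by
  refine le_of_forall_pos_le_add fun ε hε => ?_
  have hε' : 0 < ε / (N + 1) := by positivity
  obtain ⟨s, hs, ho, hsum⟩ := exists_orthonormal_sum_inner_ge (add_nonneg ha hb) hε' N
  let E : Submodule ℂ H := Submodule.span ℂ (s : Set H)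
  have hEfin : FiniteDimensional ℂ E := FiniteDimensional.span_finset ℂ s
  have hE : Module.finrank ℂ E ≤ N := (finrank_span_finset_le_card s).trans hs
  have h1 := sum_inner_le_compressionTrace (re_inner_nonneg_of_nonneg (add_nonneg ha hb)) E s
    (fun x hx => Submodule.subset_span hx) ho
  have h2 := compressionTrace_le_of_finrank_le (isSymmetric_of_nonneg ha) E hE
  have h3 := compressionTrace_le_of_finrank_le (isSymmetric_of_nonneg hb) E hE
  have h4 : N * (ε / (N + 1)) ≤ ε := by
    rw [mul_div_assoc', div_le_iff₀ (by positivity)]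
    nlinarith
  rw [compressionTrace_add] at h1
  linarith

theorem sum_singularValue_add_ge {a b : H →L[ℂ] H} (ha : 0 ≤ a) (hb : 0 ≤ b) (N : ℕ) :
    ∑ k ∈ Finset.range N, singularValue a k + ∑ k ∈ Finset.range N, singularValue b k ≤
      ∑ k ∈ Finset.range (2 * N), singularValue (a + b) k := by
  classical
  refine le_of_forall_pos_le_add fun ε hε => ?_
  have hε' : 0 < ε / (2 * (N + 1)) := by positivity
  obtain ⟨s, hs, ho, hsum⟩ := exists_orthonormal_sum_inner_ge ha hε' N
  obtain ⟨t, ht, ho', hsum'⟩ := exists_orthonormal_sum_inner_ge hb hε' N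
  let E : Submodule ℂ H := Submodule.span ℂ ((s ∪ t : Finset H) : Set H)
  have hEfin : FiniteDimensional ℂ E := FiniteDimensional.span_finset ℂ _
  have hE : Module.finrank ℂ E ≤ 2 * N := by
    refine (finrank_span_finset_le_card _).trans ((Finset.card_union_le s t).trans ?_)
    omega
  have h1 := sum_inner_le_compressionTrace (re_inner_nonneg_of_nonneg ha) E s
    (fun x hx => Submodule.subset_span (Finset.mem_union_left t hx)) ho
  have h2 := sum_inner_le_compressionTrace (re_inner_nonneg_of_nonneg hb) E t
    (fun x hx => Submodule.subset_span (Finset.mem_union_right s hx)) ho'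
  have h3 := compressionTrace_le_of_finrank_le (isSymmetric_of_nonneg (add_nonneg ha hb)) E hE
  rw [compressionTrace_add] at h3
  have h4 : N * (ε / (2 * (N + 1))) ≤ ε / 2 := by
    rw [mul_div_assoc', div_le_iff₀ (by positivity)]
    nlinarith
  linarith

end KyFan

/-! ### Operators whose singular values decay like a power -/

section Decay

variable {H : Type*} [NormedAddCommGroup H] [InnerProductSpace ℂ H]

/-- The singular values of `T` are `O(k^(-p))`. For `p > 0` this is the weak Schatten ideal of
exponent `1 / p`, and for `p = 0` it holds for all bounded operators. -/
def HasDecay (p : ℝ) (T : H →L[ℂ] H) : Prop :=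
  ∃ C : ℝ, ∀ k : ℕ, singularValue T k ≤ C * ((k : ℝ) + 1) ^ (-p)

theorem rpow_half_le {p : ℝ} (hp : 0 ≤ p) (n : ℕ) :
    (((n / 2 : ℕ) : ℝ) + 1) ^ (-p) ≤ 2 ^ p * ((n : ℝ) + 1) ^ (-p) := by
  have h1 : ((n : ℝ) + 1) / 2 ≤ ((n / 2 : ℕ) : ℝ) + 1 := by
    have : n + 1 ≤ 2 * (n / 2 + 1) := by omega
    have : (n : ℝ) + 1 ≤ 2 * (((n / 2 : ℕ) : ℝ) + 1) := by exact_mod_cast this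
    linarith
  refine (Real.rpow_le_rpow_of_nonpos (by positivity) h1 (by linarith)).trans_eq ?_
  rw [Real.div_rpow (by positivity) (by norm_num), Real.rpow_neg (by norm_num : (0 : ℝ) ≤ 2),
    div_inv_eq_mul, mul_comm]

theorem HasDecay.const_nonneg {p C : ℝ} {T : H →L[ℂ] H}
    (h : ∀ k : ℕ, singularValue T k ≤ C * ((k : ℝ) + 1) ^ (-p)) : 0 ≤ C := by
  have := (singularValue_nonneg T 0).trans (h 0)
  simpa using this

theorem HasDecay.add {p : ℝ} (hp : 0 ≤ p) {S T : H →L[ℂ] H} (hS : HasDecay p S)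
    (hT : HasDecay p T) : HasDecay p (S + T) := by
  obtain ⟨C, hC⟩ := hS
  obtain ⟨C', hC'⟩ := hT
  have h0 := HasDecay.const_nonneg hC
  have h0' := HasDecay.const_nonneg hC'
  refine ⟨(C + C') * 2 ^ p, fun n => ?_⟩
  calc singularValue (S + T) n ≤ singularValue (S + T) (n / 2 + n / 2) :=
        singularValue_antitone _ (by omega)
    _ ≤ singularValue S (n / 2) + singularValue T (n / 2) := singularValue_add_le _ _ _ _
    _ ≤ (C + C') * (((n / 2 : ℕ) : ℝ) + 1) ^ (-p) := by
        rw [add_mul]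
        exact add_le_add (hC _) (hC' _)
    _ ≤ (C + C') * (2 ^ p * ((n : ℝ) + 1) ^ (-p)) := by
        gcongr
        exact rpow_half_le hp n
    _ = _ := by ring

theorem HasDecay.mul {p q : ℝ} (hp : 0 ≤ p) (hq : 0 ≤ q) {S T : H →L[ℂ] H} (hS : HasDecay p S)
    (hT : HasDecay q T) : HasDecay (p + q) (S * T) := by
  obtain ⟨C, hC⟩ := hS
  obtain ⟨C', hC'⟩ := hT
  have h0 := HasDecay.const_nonneg hC
  have h0' := HasDecay.const_nonneg hC'
  refine ⟨C * C' * 2 ^ (p + q), fun n => ?_⟩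
  calc singularValue (S * T) n ≤ singularValue (S * T) (n / 2 + n / 2) :=
        singularValue_antitone _ (by omega)
    _ ≤ singularValue S (n / 2) * singularValue T (n / 2) := singularValue_mul_le _ _ _ _
    _ ≤ (C * (((n / 2 : ℕ) : ℝ) + 1) ^ (-p)) * (C' * (((n / 2 : ℕ) : ℝ) + 1) ^ (-q)) :=
        mul_le_mul (hC _) (hC' _) (singularValue_nonneg _ _) (by positivity)
    _ = C * C' * (((n / 2 : ℕ) : ℝ) + 1) ^ (-(p + q)) := by
        rw [neg_add, Real.rpow_add (by positivity)]
        ring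
    _ ≤ C * C' * (2 ^ (p + q) * ((n : ℝ) + 1) ^ (-(p + q))) := by
        gcongr
        exact rpow_half_le (add_nonneg hp hq) n
    _ = _ := by ring

theorem HasDecay.smul {p : ℝ} (c : ℂ) {T : H →L[ℂ] H} (hT : HasDecay p T) :
    HasDecay p (c • T) := by
  obtain ⟨C, hC⟩ := hT
  refine ⟨‖c‖ * C, fun n => ?_⟩
  rw [singularValue_smul, mul_assoc]
  exact mul_le_mul_of_nonneg_left (hC n) (norm_nonneg c)

theorem HasDecay.neg {p : ℝ} {T : H →L[ℂ] H} (hT : HasDecay p T) : HasDecay p (-T) := by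
  simpa using hT.smul (-1)

theorem HasDecay.sub {p : ℝ} (hp : 0 ≤ p) {S T : H →L[ℂ] H} (hS : HasDecay p S)
    (hT : HasDecay p T) : HasDecay p (S - T) := by
  rw [sub_eq_add_neg]
  exact hS.add hp hT.neg

theorem HasDecay.of_singularValue_le {p : ℝ} {S T : H →L[ℂ] H} (hT : HasDecay p T)
    (h : ∀ k, singularValue S k ≤ singularValue T k) : HasDecay p S := by
  obtain ⟨C, hC⟩ := hT
  exact ⟨C, fun k => (h k).trans (hC k)⟩

theorem HasDecay.mono {p q : ℝ} (hpq : q ≤ p) {T : H →L[ℂ] H} (hT : HasDecay p T) :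
    HasDecay q T := by
  obtain ⟨C, hC⟩ := hT
  refine ⟨C, fun k => (hC k).trans (mul_le_mul_of_nonneg_left ?_ (HasDecay.const_nonneg hC))⟩
  have h1 : (1 : ℝ) ≤ (k : ℝ) + 1 := by
    have := k.cast_nonneg (α := ℝ)
    linarith
  exact Real.rpow_le_rpow_of_exponent_le h1 (by linarith)

theorem hasDecay_zero (T : H →L[ℂ] H) : HasDecay 0 T :=
  ⟨‖T‖, fun k => by simpa using singularValue_le_norm T k⟩

theorem HasDecay.mul_left {p : ℝ} (hp : 0 ≤ p) (S : H →L[ℂ] H) {T : H →L[ℂ] H}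
    (hT : HasDecay p T) : HasDecay p (S * T) := by
  simpa using (hasDecay_zero S).mul le_rfl hp hT

theorem HasDecay.mul_right {p : ℝ} (hp : 0 ≤ p) {S : H →L[ℂ] H} (T : H →L[ℂ] H)
    (hS : HasDecay p S) : HasDecay p (S * T) := by
  simpa using hS.mul hp le_rfl (hasDecay_zero T)

theorem hasDecay_of_rank_le {p : ℝ} (hp : 0 ≤ p) {T : H →L[ℂ] H} {n : ℕ}
    (hT : LinearMap.rank (T : H →ₗ[ℂ] H) ≤ n) : HasDecay p T := by
  refine ⟨‖T‖ * ((n : ℝ) + 1) ^ p, fun k => ?_⟩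
  rcases le_or_gt n k with h | h
  · rw [singularValue_eq_zero (hT.trans (by exact_mod_cast h))]
    positivity
  · refine (singularValue_le_norm T k).trans ?_
    rw [mul_assoc, Real.rpow_neg (by positivity), ← div_eq_mul_inv]
    refine le_mul_of_one_le_right (norm_nonneg T) ?_
    rw [one_le_div (by positivity)]
    have : (k : ℝ) ≤ n := by exact_mod_cast h.le
    gcongr

theorem hasDecay_of_isBigO {p : ℝ} {T : H →L[ℂ] H} (hp : 0 ≤ p)
    (h : (fun k : ℕ => singularValue T k) =O[Filter.atTop] fun k : ℕ => (k : ℝ) ^ (-p)) :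
    HasDecay p T := by
  obtain ⟨C, hC0, hC⟩ := h.exists_nonneg
  obtain ⟨N, hN⟩ := Filter.eventually_atTop.1 hC.bound
  refine ⟨C * 2 ^ p + ‖T‖ * ((N : ℝ) + 1) ^ p, fun k => ?_⟩
  have hk : 0 < ((k : ℝ) + 1) ^ (-p) := by positivity
  rcases le_or_gt (N + 1) k with h | h
  · have h1 := hN k (by omega)
    rw [Real.norm_of_nonneg (singularValue_nonneg T k), Real.norm_of_nonneg (by positivity)] at h1
    have h2 : (k : ℝ) ^ (-p) ≤ 2 ^ p * ((k : ℝ) + 1) ^ (-p) := by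
      have h3 : (1 : ℝ) ≤ k := by exact_mod_cast (by omega : 1 ≤ k)
      refine (Real.rpow_le_rpow_of_nonpos (x := ((k : ℝ) + 1) / 2) (by positivity) (by linarith)
        (by linarith)).trans_eq ?_
      rw [Real.div_rpow (by positivity) (by norm_num), Real.rpow_neg (by norm_num : (0 : ℝ) ≤ 2),
        div_inv_eq_mul, mul_comm]
    calc singularValue T k ≤ C * (2 ^ p * ((k : ℝ) + 1) ^ (-p)) :=
          h1.trans (mul_le_mul_of_nonneg_left h2 hC0)
      _ = C * 2 ^ p * ((k : ℝ) + 1) ^ (-p) := by ring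
      _ ≤ _ := by
          gcongr
          exact le_add_of_nonneg_right (by positivity)
  · refine (singularValue_le_norm T k).trans ?_
    calc ‖T‖ ≤ ‖T‖ * ((N : ℝ) + 1) ^ p * ((k : ℝ) + 1) ^ (-p) := by
          rw [mul_assoc, Real.rpow_neg (by positivity), ← div_eq_mul_inv]
          refine le_mul_of_one_le_right (norm_nonneg T) ?_
          rw [one_le_div (by positivity)]
          have : (k : ℝ) ≤ N := by exact_mod_cast (by omega : k ≤ N)
          gcongr
      _ ≤ _ := by
          gcongr
          exact le_add_of_nonneg_left (by positivity)

variable [CompleteSpace H]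

theorem HasDecay.star {p : ℝ} {T : H →L[ℂ] H} (hT : HasDecay p T) : HasDecay p (star T) :=
  hT.of_singularValue_le fun k => (singularValue_star T k).le

/-- The ranges of the positive and the negative part are orthogonal. -/
theorem norm_posPart_negPart_apply {T : H →L[ℂ] H} (hT : IsSelfAdjoint T) (x : H) :
    ‖T x‖ ^ 2 = ‖T⁺ x‖ ^ 2 + ‖T⁻ x‖ ^ 2 := by
  have h1 : T x = T⁺ x - T⁻ x := by
    rw [← sub_apply, CFC.posPart_sub_negPart T hT]
  have h2 : inner ℂ (T⁺ x) (T⁻ x) = 0 := by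
    have hs : star (T⁺) = T⁺ := (IsSelfAdjoint.of_nonneg (CFC.posPart_nonneg T)).star_eq
    rw [← hs, ContinuousLinearMap.star_eq_adjoint, ContinuousLinearMap.adjoint_inner_left]
    change inner ℂ x ((T⁺ * T⁻) x) = 0
    rw [CFC.posPart_mul_negPart]
    simp
  rw [h1, @norm_sub_sq ℂ, h2]
  simp

/-- The positive part of `T` satisfies `‖T⁺ x‖ ≤ ‖T x‖`. -/
theorem HasDecay.posPart {p : ℝ} {T : H →L[ℂ] H} (hs : IsSelfAdjoint T) (hT : HasDecay p T) :
    HasDecay p T⁺ :=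
  hT.of_singularValue_le <| singularValue_le_of_norm_apply_le fun x => by
    refine (sq_le_sq₀ (norm_nonneg _) (norm_nonneg _)).1 ?_
    rw [norm_posPart_negPart_apply hs]
    exact le_add_of_nonneg_right (sq_nonneg _)

theorem HasDecay.negPart {p : ℝ} {T : H →L[ℂ] H} (hs : IsSelfAdjoint T) (hT : HasDecay p T) :
    HasDecay p T⁻ :=
  hT.of_singularValue_le <| singularValue_le_of_norm_apply_le fun x => by
    refine (sq_le_sq₀ (norm_nonneg _) (norm_nonneg _)).1 ?_
    rw [norm_posPart_negPart_apply hs]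
    exact le_add_of_nonneg_left (sq_nonneg _)

theorem HasDecay.realPart {p : ℝ} (hp : 0 ≤ p) {T : H →L[ℂ] H} (hT : HasDecay p T) :
    HasDecay p (ℜ T : H →L[ℂ] H) := by
  rw [realPart_apply_coe, ← Complex.coe_smul]
  exact (hT.add hp hT.star).smul _

theorem HasDecay.imaginaryPart {p : ℝ} (hp : 0 ≤ p) {T : H →L[ℂ] H} (hT : HasDecay p T) :
    HasDecay p (ℑ T : H →L[ℂ] H) := by
  rw [imaginaryPart_apply_coe, ← Complex.coe_smul]
  exact ((hT.sub hp hT.star).smul _).smul _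

end Decay

/-! ### Linearity and the trace property of the Dixmier trace -/

section Dixmier

variable {H : Type*} [NormedAddCommGroup H] [InnerProductSpace ℂ H]

theorem logMean_nonneg (T : H →L[ℂ] H) (N : ℕ) : 0 ≤ logMean T N :=
  div_nonneg (Finset.sum_nonneg fun k _ => singularValue_nonneg T k) (Real.log_natCast_nonneg N)

theorem HasDecay.logMean_bounded {T : H →L[ℂ] H} (hT : HasDecay 1 T) :
    ∃ C, ∀ N, ‖logMean T N‖ ≤ C := by
  obtain ⟨C, hC⟩ := hT
  have h0 := HasDecay.const_nonneg hC
  refine ⟨C * (1 / Real.log 2 + 1), fun N => ?_⟩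
  rw [Real.norm_of_nonneg (logMean_nonneg T N), logMean]
  have hl2 : 0 < Real.log 2 := Real.log_pos (by norm_num)
  rcases lt_or_ge N 2 with h | h
  -- for `N < 2` the quotient is the junk value `0`
  · have : Real.log N = 0 := by
      interval_cases N <;> simp
    rw [this, div_zero]
    positivity
  · have hl : Real.log 2 ≤ Real.log N := Real.log_le_log (by norm_num) (by exact_mod_cast h)
    rw [div_le_iff₀ (hl2.trans_le hl)]
    have h1 : ∑ k ∈ Finset.range N, singularValue T k ≤ C * (1 + Real.log N) := by
      refine (Finset.sum_le_sum fun k _ => hC k).trans ?_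
      rw [← Finset.mul_sum]
      refine mul_le_mul_of_nonneg_left ?_ h0
      have h2 := harmonic_le_one_add_log N
      rw [harmonic] at h2
      push_cast at h2
      simpa [Real.rpow_neg_one] using h2
    refine h1.trans ?_
    rw [mul_assoc]
    refine mul_le_mul_of_nonneg_left ?_ h0
    rw [add_mul, one_mul]
    have : 1 ≤ 1 / Real.log 2 * Real.log N := by
      rw [one_div, ← div_eq_inv_mul, one_le_div hl2]
      exact hl
    linarith

theorem dixmierPos_eq (ω : DixmierLimit) {T : H →L[ℂ] H} (f : BoundedContinuousFunction ℕ ℝ)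
    (hf : ∀ N, f N = logMean T N) : dixmierPos ω T = ω.toFun f := by
  have h : ∃ C, ∀ N, ‖logMean T N‖ ≤ C := ⟨‖f‖, fun N => by rw [← hf]; exact f.norm_coe_le_norm N⟩
  rw [dixmierPos, dif_pos h]
  congr 1
  ext N
  exact (hf N).symm

theorem HasDecay.exists_logMean {T : H →L[ℂ] H} (hT : HasDecay 1 T) :
    ∃ f : BoundedContinuousFunction ℕ ℝ, ∀ N, f N = logMean T N := by
  obtain ⟨C, hC⟩ := hT.logMean_bounded
  exact ⟨BoundedContinuousFunction.ofNormedAddCommGroupDiscrete (logMean T) C hC, fun _ => rfl⟩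

theorem tendsto_const_div_log (C : ℝ) :
    Filter.Tendsto (fun N : ℕ => C / Real.log N) Filter.atTop (𝓝 0) :=
  (Real.tendsto_log_atTop.comp tendsto_natCast_atTop_atTop).const_div_atTop C

theorem dixmierPos_eq_zero (ω : DixmierLimit) {p : ℝ} (hp : 1 < p) {T : H →L[ℂ] H}
    (hT : HasDecay p T) : dixmierPos ω T = 0 := by
  obtain ⟨f, hf⟩ := (hT.mono hp.le).exists_logMean
  rw [dixmierPos_eq ω f hf]
  refine ω.eq_lim f 0 ?_
  obtain ⟨C, hC⟩ := hT
  have hs : Summable fun k : ℕ => C * ((k : ℝ) + 1) ^ (-p) := by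
    have h1 : Summable fun k : ℕ => (k : ℝ) ^ (-p) := Real.summable_nat_rpow.2 (by linarith)
    have h2 := (summable_nat_add_iff 1).2 h1
    push_cast at h2
    exact h2.mul_left C
  have hs' : Summable fun k : ℕ => singularValue T k :=
    Summable.of_nonneg_of_le (singularValue_nonneg T) hC hs
  refine squeeze_zero (fun N => ?_) (fun N => ?_)
    (tendsto_const_div_log (∑' k, singularValue T k))
  · rw [hf]
    exact logMean_nonneg T N
  · rw [hf, logMean]
    have := Real.log_natCast_nonneg N
    gcongr
    exact hs'.sum_le_tsum _ fun k _ => singularValue_nonneg T k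

theorem dixmierPos_smul (ω : DixmierLimit) {c : ℝ} (hc : 0 ≤ c) {T : H →L[ℂ] H}
    (hT : HasDecay 1 T) : dixmierPos ω (c • T) = c * dixmierPos ω T := by
  obtain ⟨f, hf⟩ := hT.exists_logMean
  rw [dixmierPos_eq ω f hf, dixmierPos_eq ω (c • f), map_smul, smul_eq_mul]
  intro N
  change c • f N = _
  rw [hf, logMean, logMean, ← Complex.coe_smul]
  simp only [singularValue_smul, ← Finset.mul_sum, Complex.norm_real, Real.norm_of_nonneg hc,
    smul_eq_mul, mul_div_assoc]

theorem dixmierPos_congr (ω : DixmierLimit) {S T : H →L[ℂ] H}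
    (h : ∀ k, singularValue S k = singularValue T k) : dixmierPos ω S = dixmierPos ω T := by
  have h' : logMean S = logMean T := by
    funext N
    simp only [logMean, h]
  by_cases hb : ∃ C, ∀ N, ‖logMean T N‖ ≤ C
  · obtain ⟨C, hC⟩ := hb
    let f := BoundedContinuousFunction.ofNormedAddCommGroupDiscrete (logMean T) C hC
    rw [dixmierPos_eq ω (T := S) f fun N => by rw [h']; rfl,
      dixmierPos_eq ω (T := T) f fun N => rfl]
  · rw [dixmierPos, dixmierPos, dif_neg hb, dif_neg (by rwa [h'])]

variable [CompleteSpace H]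

/-- Additivity of the Dixmier trace on positive operators. By the inequalities of Ky Fan,
`logMean a + logMean b - logMean (a + b)` is nonnegative and bounded by
`(log N)⁻¹ ∑_{N ≤ k < 2N} μ_k(a + b) = O((log N)⁻¹)`. -/
theorem dixmierPos_add (ω : DixmierLimit) {a b : H →L[ℂ] H} (ha : 0 ≤ a) (hb : 0 ≤ b)
    (ha' : HasDecay 1 a) (hb' : HasDecay 1 b) :
    dixmierPos ω (a + b) = dixmierPos ω a + dixmierPos ω b := by
  have hab := ha'.add zero_le_one hb'
  obtain ⟨f, hf⟩ := ha'.exists_logMean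
  obtain ⟨g, hg⟩ := hb'.exists_logMean
  obtain ⟨h, hh⟩ := hab.exists_logMean
  rw [dixmierPos_eq ω f hf, dixmierPos_eq ω g hg, dixmierPos_eq ω h hh, ← map_add]
  have key : ω.toFun (f + g - h) = 0 := by
    refine ω.eq_lim _ 0 ?_
    obtain ⟨C, hC⟩ := hab
    have hC0 := HasDecay.const_nonneg hC
    refine squeeze_zero (fun N => ?_) (fun N => ?_) (tendsto_const_div_log C)
    · rw [BoundedContinuousFunction.coe_sub, BoundedContinuousFunction.coe_add, Pi.sub_apply,
        Pi.add_apply, hf, hg, hh, sub_nonneg, logMean, logMean, logMean, ← add_div]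
      have := Real.log_natCast_nonneg N
      gcongr
      exact sum_singularValue_add_le ha hb N
    · rw [BoundedContinuousFunction.coe_sub, BoundedContinuousFunction.coe_add, Pi.sub_apply,
        Pi.add_apply, hf, hg, hh, logMean, logMean, logMean, ← add_div, ← sub_div]
      have := Real.log_natCast_nonneg N
      gcongr
      have h1 := sum_singularValue_add_ge ha hb N
      have h2 : ∑ k ∈ Finset.range N, singularValue (a + b) (N + k) ≤ C := by
        calc ∑ k ∈ Finset.range N, singularValue (a + b) (N + k)
            ≤ ∑ _k ∈ Finset.range N, C * ((N : ℝ) + 1) ^ (-1 : ℝ) :=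
              Finset.sum_le_sum fun k _ =>
                (singularValue_antitone _ (Nat.le_add_right N k)).trans (hC N)
          _ = C * (N / ((N : ℝ) + 1)) := by
              rw [Finset.sum_const, Finset.card_range, Real.rpow_neg_one, nsmul_eq_mul]
              ring
          _ ≤ C * 1 := by
              gcongr
              rw [div_le_one (by positivity)]
              linarith
          _ = C := mul_one C
      rw [two_mul, Finset.sum_range_add] at h1
      linarith
  rw [map_sub, sub_eq_zero] at key
  exact key.symm

/-- The Dixmier trace on self-adjoint operators. -/
noncomputable def dixmierSelfAdjoint (ω : DixmierLimit) (T : H →L[ℂ] H) : ℝ :=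
  dixmierPos ω T⁺ - dixmierPos ω T⁻

theorem dixmierTrace_eq (ω : DixmierLimit) (T : H →L[ℂ] H) :
    dixmierTrace ω T = (dixmierSelfAdjoint ω (ℜ T : H →L[ℂ] H) : ℂ) +
      Complex.I * (dixmierSelfAdjoint ω (ℑ T : H →L[ℂ] H) : ℂ) := rfl

theorem dixmierPos_sub_eq (ω : DixmierLimit) {P Q P' Q' : H →L[ℂ] H} (hP : 0 ≤ P) (hQ : 0 ≤ Q)
    (hP' : 0 ≤ P') (hQ' : 0 ≤ Q') (dP : HasDecay 1 P) (dQ : HasDecay 1 Q) (dP' : HasDecay 1 P')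
    (dQ' : HasDecay 1 Q') (h : P - Q = P' - Q') :
    dixmierPos ω P - dixmierPos ω Q = dixmierPos ω P' - dixmierPos ω Q' := by
  have h2 := congrArg (dixmierPos ω) (sub_eq_sub_iff_add_eq_add.1 h)
  rw [dixmierPos_add ω hP hQ' dP dQ', dixmierPos_add ω hP' hQ dP' dQ] at h2
  linarith

/-- The Dixmier trace of a self-adjoint operator may be computed from any decomposition as a
difference of positive operators. -/
theorem dixmierSelfAdjoint_sub (ω : DixmierLimit) {P Q : H →L[ℂ] H} (hP : 0 ≤ P) (hQ : 0 ≤ Q)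
    (hP' : HasDecay 1 P) (hQ' : HasDecay 1 Q) :
    dixmierSelfAdjoint ω (P - Q) = dixmierPos ω P - dixmierPos ω Q := by
  have hs : IsSelfAdjoint (P - Q) := (IsSelfAdjoint.of_nonneg hP).sub (IsSelfAdjoint.of_nonneg hQ)
  have hd : HasDecay 1 (P - Q) := hP'.sub zero_le_one hQ'
  generalize hT : P - Q = T at hs hd
  refine dixmierPos_sub_eq ω (CFC.posPart_nonneg T) (CFC.negPart_nonneg T) hP hQ (hd.posPart hs)
    (hd.negPart hs) hP' hQ' ?_
  rw [CFC.posPart_sub_negPart T hs, hT]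

theorem dixmierSelfAdjoint_add (ω : DixmierLimit) {S T : H →L[ℂ] H} (hS : IsSelfAdjoint S)
    (hT : IsSelfAdjoint T) (hS' : HasDecay 1 S) (hT' : HasDecay 1 T) :
    dixmierSelfAdjoint ω (S + T) = dixmierSelfAdjoint ω S + dixmierSelfAdjoint ω T := by
  have h1 : S + T = (S⁺ + T⁺) - (S⁻ + T⁻) := by
    conv_lhs => rw [← CFC.posPart_sub_negPart S hS, ← CFC.posPart_sub_negPart T hT]
    abel
  have pS := CFC.posPart_nonneg S
  have nS := CFC.negPart_nonneg S
  have pT := CFC.posPart_nonneg T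
  have nT := CFC.negPart_nonneg T
  rw [h1, dixmierSelfAdjoint_sub ω (add_nonneg pS pT) (add_nonneg nS nT)
    ((hS'.posPart hS).add zero_le_one (hT'.posPart hT))
    ((hS'.negPart hS).add zero_le_one (hT'.negPart hT)),
    dixmierPos_add ω pS pT (hS'.posPart hS) (hT'.posPart hT),
    dixmierPos_add ω nS nT (hS'.negPart hS) (hT'.negPart hT), dixmierSelfAdjoint,
    dixmierSelfAdjoint]
  ring

theorem dixmierSelfAdjoint_smul (ω : DixmierLimit) (c : ℝ) {T : H →L[ℂ] H}
    (hT : IsSelfAdjoint T) (hT' : HasDecay 1 T) :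
    dixmierSelfAdjoint ω (c • T) = c * dixmierSelfAdjoint ω T := by
  rcases le_total 0 c with hc | hc
  · rw [dixmierSelfAdjoint, CFC.posPart_smul_of_nonneg hc, CFC.negPart_smul_of_nonneg hc,
      dixmierPos_smul ω hc (hT'.posPart hT), dixmierPos_smul ω hc (hT'.negPart hT),
      dixmierSelfAdjoint]
    ring
  · rw [dixmierSelfAdjoint, CFC.posPart_smul_of_nonpos hc, CFC.negPart_smul_of_nonpos hc,
      dixmierPos_smul ω (neg_nonneg.2 hc) (hT'.posPart hT),
      dixmierPos_smul ω (neg_nonneg.2 hc) (hT'.negPart hT), dixmierSelfAdjoint]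
    ring

theorem dixmierTrace_add (ω : DixmierLimit) {S T : H →L[ℂ] H} (hS : HasDecay 1 S)
    (hT : HasDecay 1 T) : dixmierTrace ω (S + T) = dixmierTrace ω S + dixmierTrace ω T := by
  simp only [dixmierTrace_eq, map_add, AddSubgroup.coe_add]
  rw [dixmierSelfAdjoint_add ω (ℜ S).2 (ℜ T).2 (hS.realPart zero_le_one) (hT.realPart zero_le_one),
    dixmierSelfAdjoint_add ω (ℑ S).2 (ℑ T).2 (hS.imaginaryPart zero_le_one)
      (hT.imaginaryPart zero_le_one)]
  push_cast
  ring

theorem dixmierTrace_smul (ω : DixmierLimit) (c : ℂ) {T : H →L[ℂ] H} (hT : HasDecay 1 T) :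
    dixmierTrace ω (c • T) = c * dixmierTrace ω T := by
  have hr := hT.realPart zero_le_one
  have hi := hT.imaginaryPart zero_le_one
  have hsr : ∀ r : ℝ, IsSelfAdjoint (r • (ℜ T : H →L[ℂ] H)) := fun r =>
    (r • ℜ T : selfAdjoint (H →L[ℂ] H)).2
  have hsi : ∀ r : ℝ, IsSelfAdjoint (r • (ℑ T : H →L[ℂ] H)) := fun r =>
    (r • ℑ T : selfAdjoint (H →L[ℂ] H)).2
  have hdr : ∀ r : ℝ, HasDecay 1 (r • (ℜ T : H →L[ℂ] H)) := fun r => by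
    rw [← Complex.coe_smul]; exact hr.smul _
  have hdi : ∀ r : ℝ, HasDecay 1 (r • (ℑ T : H →L[ℂ] H)) := fun r => by
    rw [← Complex.coe_smul]; exact hi.smul _
  have h1 : dixmierSelfAdjoint ω (ℜ (c • T) : H →L[ℂ] H) =
      c.re * dixmierSelfAdjoint ω (ℜ T : H →L[ℂ] H) -
        c.im * dixmierSelfAdjoint ω (ℑ T : H →L[ℂ] H) := by
    have : (ℜ (c • T) : H →L[ℂ] H) = c.re • (ℜ T : H →L[ℂ] H) + (-c.im) • (ℑ T : H →L[ℂ] H) := by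
      rw [realPart_smul]
      simp [sub_eq_add_neg]
    rw [this, dixmierSelfAdjoint_add ω (hsr _) (hsi _) (hdr _) (hdi _),
      dixmierSelfAdjoint_smul ω _ (ℜ T).2 hr, dixmierSelfAdjoint_smul ω _ (ℑ T).2 hi]
    ring
  have h2 : dixmierSelfAdjoint ω (ℑ (c • T) : H →L[ℂ] H) =
      c.re * dixmierSelfAdjoint ω (ℑ T : H →L[ℂ] H) +
        c.im * dixmierSelfAdjoint ω (ℜ T : H →L[ℂ] H) := by
    have : (ℑ (c • T) : H →L[ℂ] H) = c.re • (ℑ T : H →L[ℂ] H) + c.im • (ℜ T : H →L[ℂ] H) := by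
      rw [imaginaryPart_smul]
      simp
    rw [this, dixmierSelfAdjoint_add ω (hsi _) (hsr _) (hdi _) (hdr _),
      dixmierSelfAdjoint_smul ω _ (ℜ T).2 hr, dixmierSelfAdjoint_smul ω _ (ℑ T).2 hi]
  rw [dixmierTrace_eq, dixmierTrace_eq, h1, h2]
  conv_rhs => rw [← Complex.re_add_im c]
  push_cast
  linear_combination (c.im : ℂ) * dixmierSelfAdjoint ω (ℑ T : H →L[ℂ] H) * Complex.I_mul_I * (-1)

/-- The Dixmier trace vanishes on operators with summable singular values. -/
theorem dixmierTrace_eq_zero (ω : DixmierLimit) {p : ℝ} (hp : 1 < p) {T : H →L[ℂ] H}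
    (hT : HasDecay p T) : dixmierTrace ω T = 0 := by
  have hr := hT.realPart (by linarith)
  have hi := hT.imaginaryPart (by linarith)
  rw [dixmierTrace, dixmierPos_eq_zero ω hp (hr.posPart (ℜ T).2),
    dixmierPos_eq_zero ω hp (hr.negPart (ℜ T).2), dixmierPos_eq_zero ω hp (hi.posPart (ℑ T).2),
    dixmierPos_eq_zero ω hp (hi.negPart (ℑ T).2)]
  simp

theorem singularValue_unitary_conj (U : unitary (H →L[ℂ] H)) (T : H →L[ℂ] H) (k : ℕ) :
    singularValue ((U : H →L[ℂ] H) * T * star (U : H →L[ℂ] H)) k = singularValue T k := by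
  have hle : ∀ (V : unitary (H →L[ℂ] H)) (S : H →L[ℂ] H),
      singularValue ((V : H →L[ℂ] H) * S * star (V : H →L[ℂ] H)) k ≤ singularValue S k := by
    intro V S
    have h1 : ‖(V : H →L[ℂ] H)‖ ≤ 1 := by
      rcases subsingleton_or_nontrivial H with h | h
      · have : (V : H →L[ℂ] H) = 0 := Subsingleton.elim _ _
        rw [this, norm_zero]
        exact zero_le_one
      · exact (CStarRing.norm_coe_unitary V).le
    refine (singularValue_mul_le_right _ _ _).trans ?_
    rw [norm_star]
    have h2 := singularValue_mul_le_left (V : H →L[ℂ] H) S k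
    have h3 := singularValue_nonneg S k
    have h4 := singularValue_nonneg ((V : H →L[ℂ] H) * S) k
    calc _ ≤ singularValue ((V : H →L[ℂ] H) * S) k * 1 := by gcongr
      _ ≤ ‖(V : H →L[ℂ] H)‖ * singularValue S k := by rwa [mul_one]
      _ ≤ 1 * singularValue S k := by gcongr
      _ = _ := one_mul _
  refine le_antisymm (hle U T) ?_
  have h := hle (star U) ((U : H →L[ℂ] H) * T * star (U : H →L[ℂ] H))
  have e : ((star U : unitary (H →L[ℂ] H)) : H →L[ℂ] H) *
      ((U : H →L[ℂ] H) * T * star (U : H →L[ℂ] H)) *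
        star ((star U : unitary (H →L[ℂ] H)) : H →L[ℂ] H) = T := by
    rw [Unitary.coe_star, star_star]
    calc _ = (star (U : H →L[ℂ] H) * U) * T * (star (U : H →L[ℂ] H) * U) := by
          simp only [mul_assoc]
      _ = T := by rw [Unitary.coe_star_mul_self, one_mul, mul_one]
  rwa [e] at h

theorem dixmierSelfAdjoint_unitary_conj (ω : DixmierLimit) (U : unitary (H →L[ℂ] H))
    {T : H →L[ℂ] H} (hs : IsSelfAdjoint T) (hT : HasDecay 1 T) :
    dixmierSelfAdjoint ω ((U : H →L[ℂ] H) * T * star (U : H →L[ℂ] H)) =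
      dixmierSelfAdjoint ω T := by
  have hd : ∀ {S : H →L[ℂ] H}, HasDecay 1 S →
      HasDecay 1 ((U : H →L[ℂ] H) * S * star (U : H →L[ℂ] H)) := fun h =>
    (h.mul_left zero_le_one _).mul_right zero_le_one _
  have h1 : (U : H →L[ℂ] H) * T * star (U : H →L[ℂ] H) =
      (U : H →L[ℂ] H) * T⁺ * star (U : H →L[ℂ] H) - (U : H →L[ℂ] H) * T⁻ * star (U : H →L[ℂ] H) := by
    rw [← sub_mul, ← mul_sub, CFC.posPart_sub_negPart T hs]
  rw [h1, dixmierSelfAdjoint_sub ω (star_right_conjugate_nonneg (CFC.posPart_nonneg T) _)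
    (star_right_conjugate_nonneg (CFC.negPart_nonneg T) _) (hd (hT.posPart hs)) (hd (hT.negPart hs)),
    dixmierSelfAdjoint, dixmierPos_congr ω (singularValue_unitary_conj U _),
    dixmierPos_congr ω (singularValue_unitary_conj U _)]

theorem dixmierTrace_unitary_conj (ω : DixmierLimit) (U : unitary (H →L[ℂ] H))
    {T : H →L[ℂ] H} (hT : HasDecay 1 T) :
    dixmierTrace ω ((U : H →L[ℂ] H) * T * star (U : H →L[ℂ] H)) = dixmierTrace ω T := by
  have hr : (ℜ ((U : H →L[ℂ] H) * T * star (U : H →L[ℂ] H)) : H →L[ℂ] H) =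
      (U : H →L[ℂ] H) * (ℜ T : H →L[ℂ] H) * star (U : H →L[ℂ] H) := by
    simp only [realPart_apply_coe, star_mul, star_star, mul_smul_comm, smul_mul_assoc, mul_add,
      add_mul, mul_assoc]
  have hi : (ℑ ((U : H →L[ℂ] H) * T * star (U : H →L[ℂ] H)) : H →L[ℂ] H) =
      (U : H →L[ℂ] H) * (ℑ T : H →L[ℂ] H) * star (U : H →L[ℂ] H) := by
    simp only [imaginaryPart_apply_coe, star_mul, star_star, mul_smul_comm, smul_mul_assoc, mul_sub,
      sub_mul, mul_assoc]
  rw [dixmierTrace_eq, dixmierTrace_eq, hr, hi,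
    dixmierSelfAdjoint_unitary_conj ω U (ℜ T).2 (hT.realPart zero_le_one),
    dixmierSelfAdjoint_unitary_conj ω U (ℑ T).2 (hT.imaginaryPart zero_le_one)]

/-- The Dixmier trace is a trace: every bounded operator is a linear combination of unitaries. -/
theorem dixmierTrace_mul_comm (ω : DixmierLimit) (b : H →L[ℂ] H) {T : H →L[ℂ] H}
    (hT : HasDecay 1 T) : dixmierTrace ω (b * T) = dixmierTrace ω (T * b) := by
  have hb : b ∈ Submodule.span ℂ (unitary (H →L[ℂ] H) : Set (H →L[ℂ] H)) := by
    rw [CStarAlgebra.span_unitary]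
    trivial
  induction hb using Submodule.span_induction with
  | mem U hU =>
    have h := dixmierTrace_unitary_conj ω ⟨U, hU⟩ (hT.mul_right zero_le_one U)
    rw [← h]
    congr 1
    change U * T = U * (T * U) * star U
    rw [mul_assoc, mul_assoc, Unitary.mul_star_self_of_mem hU, mul_one]
  | zero => simp
  | add x y _ _ hx hy =>
    rw [add_mul, mul_add, dixmierTrace_add ω (hT.mul_left zero_le_one x)
      (hT.mul_left zero_le_one y), dixmierTrace_add ω (hT.mul_right zero_le_one x)
      (hT.mul_right zero_le_one y), hx, hy]
  | smul c x _ hx =>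
    rw [smul_mul_assoc, mul_smul_comm, dixmierTrace_smul ω c (hT.mul_left zero_le_one x),
      dixmierTrace_smul ω c (hT.mul_right zero_le_one x), hx]

end Dixmier

/-! ### Spectral decomposition of `D` and commutators with `ds` -/

theorem exists_mem_spectrum_ne_zero {B : Type*} [CStarAlgebra B] (q : B) [IsStarNormal q]
    (hq : q ≠ 0) : ∃ μ ∈ spectrum ℂ q, μ ≠ 0 := by
  by_contra! h
  have h1 : spectralRadius ℂ q = 0 := by
    rw [spectralRadius, ENNReal.iSup_eq_zero]
    intro μ
    rw [ENNReal.iSup_eq_zero]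
    intro hμ
    simp [h μ hμ]
  rw [IsStarNormal.spectralRadius_eq_nnnorm, ENNReal.coe_eq_zero, nnnorm_eq_zero] at h1
  exact hq h1

section Resolvent

variable {H : Type*} [NormedAddCommGroup H] [InnerProductSpace ℂ H]
variable {T : H →ₗ.[ℂ] H} {R R' : H →L[ℂ] H}

theorem IsResolvent.adjoint [CompleteSpace H] (hT : T.IsFormalAdjoint T) (hR : IsResolvent T Complex.I R)
    (hR' : IsResolvent T (-Complex.I) R') : star R = R' := by
  rw [ContinuousLinearMap.star_eq_adjoint]
  refine (ContinuousLinearMap.eq_adjoint_iff R' R |>.2 fun z y => ?_).symm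
  obtain ⟨m, e⟩ := hR.1 y
  obtain ⟨m', e'⟩ := hR'.1 z
  have h := hT ⟨R' z, m'⟩ ⟨R y, m⟩
  change inner ℂ (T ⟨R' z, m'⟩) (R y) = inner ℂ (R' z) (T ⟨R y, m⟩) at h
  conv_rhs => rw [← e']
  conv_lhs => rw [← e]
  rw [inner_sub_left, inner_sub_right, h, inner_smul_left, inner_smul_right]
  simp

/-- The resolvent identity for `(D - i)⁻¹` and `(D + i)⁻¹`. -/
theorem IsResolvent.sub_eq (hR : IsResolvent T Complex.I R) (hR' : IsResolvent T (-Complex.I) R') :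
    R - R' = (2 * Complex.I) • (R * R') ∧ R - R' = (2 * Complex.I) • (R' * R) := by
  constructor
  · ext y
    obtain ⟨m', e'⟩ := hR'.1 y
    have h := hR.2 ⟨R' y, m'⟩
    have h2 : T ⟨R' y, m'⟩ = y - Complex.I • R' y := by
      rw [sub_eq_iff_eq_add.1 e', neg_smul, sub_eq_add_neg]
    rw [h2] at h
    simp only [map_sub, map_smul] at h
    change R y - R' y = (2 * Complex.I) • R (R' y)
    generalize R (R' y) = w at h ⊢
    rw [← h]
    module
  · ext y
    obtain ⟨m, e⟩ := hR.1 y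
    have h := hR'.2 ⟨R y, m⟩
    have h2 : T ⟨R y, m⟩ = y + Complex.I • R y := by
      rw [sub_eq_iff_eq_add.1 e]
    rw [h2] at h
    simp only [map_sub, map_add, map_smul] at h
    change R y - R' y = (2 * Complex.I) • R' (R y)
    generalize R' (R y) = w at h ⊢
    rw [← h]
    module

theorem IsResolvent.mul_comm (hR : IsResolvent T Complex.I R)
    (hR' : IsResolvent T (-Complex.I) R') : R * R' = R' * R := by
  have h := (hR.sub_eq hR').1.symm.trans (hR.sub_eq hR').2
  exact smul_right_injective _ (mul_ne_zero two_ne_zero Complex.I_ne_zero) h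

end Resolvent

namespace SpectralTriple

variable {H : Type*} [NormedAddCommGroup H] [InnerProductSpace ℂ H] [CompleteSpace H]
  [TopologicalSpace.SeparableSpace H]
variable {A : Type*} [Ring A] [Algebra ℂ A] [StarRing A] [StarModule ℂ A]
variable (S : SpectralTriple A H)

theorem mem_iSup_eigenspace_orthogonal (x : H) : x ∈ (⨆ t : ℝ, S.eigenspace t)ᗮ ↔
    ∀ t, ∀ e ∈ S.eigenspace t, inner ℂ e x = 0 := by
  rw [Submodule.mem_orthogonal]
  constructor
  · intro h t e he
    exact h e (Submodule.mem_iSup_of_mem t he)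
  · intro h e he
    induction he using Submodule.iSup_induction' with
    | mem t e he => exact h t e he
    | zero => exact inner_zero_left _
    | add e f _ _ he hf => rw [inner_add_left, he, hf, add_zero]

/-- The eigenvectors of `D` span a dense subspace: on the orthogonal complement of the
eigenspaces the resolvent is compact, normal and injective, and it has no eigenvectors. -/
theorem iSup_eigenspace_orthogonal : (⨆ t : ℝ, S.eigenspace t)ᗮ = ⊥ := by
  obtain ⟨R, hR, hRc⟩ := S.compactResolvent Complex.I (by simp)
  obtain ⟨R', hR', -⟩ := S.compactResolvent (-Complex.I) (by simp)
  have hstar : star R = R' := hR.adjoint S.isFormalAdjoint hR'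
  have hcomm : R * R' = R' * R := hR.mul_comm hR'
  set K := (⨆ t : ℝ, S.eigenspace t)ᗮ with hK
  have hmem : ∀ x : H, x ∈ K ↔ ∀ t, ∀ e ∈ S.eigenspace t, inner ℂ e x = 0 :=
    S.mem_iSup_eigenspace_orthogonal
  -- the resolvents act on the eigenspaces by scalars
  have hscal : ∀ (z : ℂ) (Q : H →L[ℂ] H), z.im ≠ 0 → IsResolvent S.dirac z Q → ∀ (t : ℝ),
      ∀ e ∈ S.eigenspace t, ∃ w : ℂ, Q e = w • e := by
    rintro z Q hz hQ t e ⟨hd, he⟩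
    have h := hQ.2 ⟨e, hd⟩
    rw [he, ← sub_smul, map_smul] at h
    have h0 : (t : ℂ) - z ≠ 0 := by
      intro h0
      apply hz
      rw [← sub_eq_zero.1 h0, Complex.ofReal_im]
    exact ⟨((t : ℂ) - z)⁻¹, (eq_inv_smul_iff₀ h0).2 h⟩
  have hRK : ∀ x ∈ K, R x ∈ K := by
    intro x hx
    rw [hmem] at hx ⊢
    intro t e he
    obtain ⟨w, hw⟩ := hscal _ R' (by simp) hR' t e he
    rw [← ContinuousLinearMap.adjoint_inner_left, ← ContinuousLinearMap.star_eq_adjoint, hstar, hw,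
      inner_smul_left, hx t e he, mul_zero]
  have hRK' : ∀ x ∈ K, R' x ∈ K := by
    intro x hx
    rw [hmem] at hx ⊢
    intro t e he
    obtain ⟨w, hw⟩ := hscal _ R (by simp) hR t e he
    rw [← hstar, ContinuousLinearMap.star_eq_adjoint, ContinuousLinearMap.adjoint_inner_right, hw,
      inner_smul_left, hx t e he, mul_zero]
  have hKc : CompleteSpace K := (Submodule.isClosed_orthogonal _).completeSpace_coe
  let Q : K →L[ℂ] K := R.restrict hRK
  let Q' : K →L[ℂ] K := R'.restrict hRK'
  have hQstar : star Q = Q' := by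
    rw [ContinuousLinearMap.star_eq_adjoint]
    refine (ContinuousLinearMap.eq_adjoint_iff Q' Q |>.2 fun x y => ?_).symm
    change inner ℂ (R' x) (y : H) = inner ℂ (x : H) (R y)
    rw [← hstar, ContinuousLinearMap.star_eq_adjoint, ContinuousLinearMap.adjoint_inner_left]
  have hnorm : IsStarNormal Q := ⟨by
    rw [hQstar]
    ext x
    exact (congrFun (congrArg DFunLike.coe hcomm) (x : H)).symm⟩
  have hQc : IsCompactOperator Q := hRc.restrict' hRK
  rw [← Submodule.subsingleton_iff_eq_bot]
  by_contra! hnt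
  obtain ⟨x, hx⟩ := exists_ne (0 : K)
  have hQ0 : Q ≠ 0 := by
    intro h
    have h1 : R x = 0 := congrArg Subtype.val (congrFun (congrArg DFunLike.coe h) x)
    obtain ⟨m, e⟩ := hR.1 x
    have h2 : (⟨R x, m⟩ : S.dirac.domain) = 0 := Subtype.ext h1
    rw [h2, h1, LinearPMap.map_zero, smul_zero, sub_zero] at e
    exact hx (Subtype.ext e.symm)
  obtain ⟨μ, hμ, hμ0⟩ := exists_mem_spectrum_ne_zero Q hQ0
  have hev := (hQc.hasEigenvalue_iff_mem_spectrum hμ0).2 hμ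
  obtain ⟨v, hv⟩ := hev.exists_hasEigenvector
  have hv0 : (v : H) ≠ 0 := fun h => hv.2 (Subtype.ext h)
  have hRv : R v = μ • (v : H) := congrArg Subtype.val hv.apply_eq_smul
  obtain ⟨m, e⟩ := hR.1 v
  have hvd : (v : H) ∈ S.dirac.domain := by
    rw [hRv] at m
    have := Submodule.smul_mem _ μ⁻¹ m
    rwa [inv_smul_smul₀ hμ0] at this
  have hDv : S.dirac ⟨v, hvd⟩ = (Complex.I + μ⁻¹) • (v : H) := by
    have h1 : (⟨R v, m⟩ : S.dirac.domain) = μ • ⟨v, hvd⟩ := Subtype.ext hRv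
    rw [h1, LinearPMap.map_smul, hRv] at e
    have h2 : μ • S.dirac ⟨v, hvd⟩ = (v : H) + (Complex.I * μ) • (v : H) := by
      rw [sub_eq_iff_eq_add, smul_smul] at e
      exact e
    rw [← eq_inv_smul_iff₀ hμ0] at h2
    rw [h2, smul_add, smul_smul, add_smul, add_comm]
    congr 2
    field_simp
  have hreal : starRingEnd ℂ (Complex.I + μ⁻¹) = Complex.I + μ⁻¹ := by
    have h := S.isFormalAdjoint ⟨v, hvd⟩ ⟨v, hvd⟩
    rw [hDv] at h
    change inner ℂ ((Complex.I + μ⁻¹) • (v : H)) (v : H) =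
      inner ℂ (v : H) ((Complex.I + μ⁻¹) • (v : H)) at h
    rw [inner_smul_left, inner_smul_right] at h
    exact mul_right_cancel₀ (inner_self_ne_zero.2 hv0) h
  obtain ⟨t, ht⟩ := Complex.conj_eq_iff_real.1 hreal
  have hvt : (v : H) ∈ S.eigenspace t := ⟨hvd, by rw [hDv, ht]⟩
  have := (hmem v).1 v.2 t v hvt
  exact hv0 (inner_self_eq_zero.1 this)

theorem proj_proj (s t : ℝ) (x : H) : S.proj s (S.proj t x) = if s = t then S.proj t x else 0 := by
  split_ifs with h
  · subst h
    exact Submodule.starProjection_eq_self_iff.2 (S.proj_mem s x)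
  · refine (Submodule.starProjection_apply_eq_zero_iff _).2 ?_
    rw [Submodule.mem_orthogonal]
    intro e he
    exact S.orthogonalFamily h ⟨e, he⟩ ⟨_, S.proj_mem t x⟩

/-- A vector is determined by its components in the eigenspaces of `D`. -/
theorem ext_proj {x y : H} (h : ∀ t, S.proj t x = S.proj t y) : x = y := by
  rw [← sub_eq_zero, ← Submodule.mem_bot ℂ, ← S.iSup_eigenspace_orthogonal,
    mem_iSup_eigenspace_orthogonal]
  intro t e he
  have h1 : S.proj t (x - y) = 0 := by rw [map_sub, h, sub_self]
  exact (Submodule.mem_orthogonal _ _).1 ((Submodule.starProjection_apply_eq_zero_iff _).1 h1) e he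

theorem proj_spectralCalc (f : ℝ → ℝ) (x : (S.spectralCalc f).domain) (s : ℝ) :
    S.proj s (S.spectralCalc f x) = (f s : ℂ) • S.proj s x := by
  have hs : Summable fun t => (f t : ℂ) • S.proj t x := (S.summable_smul_proj_iff f x).2 x.2
  change S.proj s (∑' t, (f t : ℂ) • S.proj t x) = _
  rw [(S.proj s).map_tsum hs, tsum_eq_single s]
  · rw [map_smul, proj_proj, if_pos rfl]
  · intro t ht
    rw [map_smul, proj_proj, if_neg ht.symm, smul_zero]

theorem proj_absDirac (x : S.absDirac.domain) (s : ℝ) :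
    S.proj s (S.absDirac x) = ((|s| : ℝ) : ℂ) • S.proj s x :=
  S.proj_spectralCalc (fun t => |t|) x s

theorem proj_ds (x : H) (s : ℝ) : S.proj s (S.ds x) = ((|s|⁻¹ : ℝ) : ℂ) • S.proj s x :=
  S.proj_spectralCalc (fun t => |t|⁻¹)
    ⟨x, S.mem_domain_of_bounded S.exists_bound_inv.choose_spec x⟩ s

theorem abs_mul_inv_smul_proj (x : H) (s : ℝ) :
    ((|s| : ℝ) : ℂ) • ((|s|⁻¹ : ℝ) : ℂ) • S.proj s x = S.proj s (x - S.proj 0 x) := by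
  rw [map_sub, proj_proj]
  split_ifs with h
  · subst h
    simp
  · have : (|s| : ℝ) ≠ 0 := abs_ne_zero.2 h
    rw [smul_smul, ← Complex.ofReal_mul, mul_inv_cancel₀ this, Complex.ofReal_one, one_smul,
      sub_zero]

theorem ds_mem_domain (y : H) : S.ds y ∈ S.absDirac.domain := by
  change Summable fun t => ‖((|t| : ℝ) : ℂ) • S.proj t (S.ds y)‖ ^ 2
  simp only [proj_ds, abs_mul_inv_smul_proj]
  exact S.summable_proj_sq _

theorem absDirac_ds (y : H) : S.absDirac ⟨S.ds y, S.ds_mem_domain y⟩ = y - S.proj 0 y :=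
  S.ext_proj fun t => by
    rw [proj_absDirac, proj_ds, abs_mul_inv_smul_proj]

theorem ds_absDirac (x : S.absDirac.domain) : S.ds (S.absDirac x) = (x : H) - S.proj 0 x :=
  S.ext_proj fun t => by
    rw [proj_ds, proj_absDirac, smul_comm, abs_mul_inv_smul_proj]

/-- The commutator of `ds` with `b` is `ds [|D|, b] ds`, up to the finite rank operators coming from
the kernel of `D`. -/
theorem commutator_ds {b c : H →L[ℂ] H} (h : IsCommutator S.absDirac b c) :
    b * S.ds - S.ds * b =
      S.ds * c * S.ds + S.proj 0 * (b * S.ds) - S.ds * b * S.proj 0 := by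
  ext y
  obtain ⟨m, e⟩ := h ⟨S.ds y, S.ds_mem_domain y⟩
  change b (S.ds y) - S.ds (b y) =
    S.ds (c (S.ds y)) + S.proj 0 (b (S.ds y)) - S.ds (b (S.proj 0 y))
  have e' : S.absDirac ⟨b (S.ds y), m⟩ - b (y - S.proj 0 y) = c (S.ds y) := by
    rw [← S.absDirac_ds y]
    exact e
  rw [← e', map_sub, S.ds_absDirac, map_sub, map_sub]
  abel

theorem finiteDimensional_ker : FiniteDimensional ℂ (S.eigenspace 0) := by
  obtain ⟨R, hR, hc⟩ := S.exists_resolvent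
  have h := ContinuousLinearMap.finite_dimensional_eigenspace hc Complex.I Complex.I_ne_zero
  refine Submodule.finiteDimensional_of_le (S₂ := Module.End.eigenspace R.toLinearMap Complex.I) ?_
  intro x hx
  rw [Module.End.mem_eigenspace_iff]
  have h1 := (S.resolvent_eigenspace hR).1 hx
  rw [Complex.ofReal_zero, zero_sub] at h1
  conv_rhs => rw [← h1]
  rw [smul_smul]
  simp

theorem hasDecay_proj {p : ℝ} (hp : 0 ≤ p) : HasDecay p (S.proj 0) := by
  have := S.finiteDimensional_ker
  refine hasDecay_of_rank_le (n := Module.finrank ℂ (S.eigenspace 0)) hp ?_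
  rw [Module.finrank_eq_rank]
  refine Submodule.rank_mono ?_
  rintro _ ⟨x, rfl⟩
  exact S.proj_mem 0 x

variable {S}

theorem HasDimension.hasDecay_ds (h : S.HasDimension 3) : HasDecay (1 / 3) S.ds :=
  hasDecay_of_isBigO (by norm_num) (by simpa using h.2)

theorem HasDimension.hasDecay_mul_ds (h : S.HasDimension 3) (T : H →L[ℂ] H) :
    HasDecay 1 (T * S.ds ^ 3) := by
  have h1 := h.hasDecay_ds
  have h2 := (h1.mul (by norm_num) (by norm_num) (h1.mul (by norm_num) (by norm_num) h1)).mul_left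
    (by norm_num) T
  rw [pow_three]
  convert h2 using 1
  norm_num

/-- The commutator `[b, ds³]` is of order `ds⁴`. -/
theorem HasDimension.hasDecay_commutator (h : S.HasDimension 3) {b : H →L[ℂ] H}
    (hb : S.InDomainPow 1 b) : HasDecay (4 / 3) (b * S.ds ^ 3 - S.ds ^ 3 * b) := by
  obtain ⟨c, hc, -⟩ := hb
  have h1 := h.hasDecay_ds
  have h2 : HasDecay (2 / 3) (b * S.ds - S.ds * b) := by
    rw [S.commutator_ds hc]
    have h3 : HasDecay (2 / 3) (S.ds * c * S.ds) := by
      have := (h1.mul_right (by norm_num) c).mul (by norm_num) (by norm_num) h1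
      norm_num at this
      exact this
    exact (h3.add (by norm_num) ((S.hasDecay_proj (by norm_num)).mul_right (by norm_num) _)).sub
      (by norm_num) ((S.hasDecay_proj (by norm_num)).mul_left (by norm_num) _)
  -- the Leibniz rule for `[b, ·]`
  have h3 : b * S.ds ^ 3 - S.ds ^ 3 * b = (b * S.ds - S.ds * b) * (S.ds * S.ds) +
      S.ds * ((b * S.ds - S.ds * b) * S.ds) + (S.ds * S.ds) * (b * S.ds - S.ds * b) := by
    noncomm_ring
  have h4 : HasDecay (2 / 3) (S.ds * S.ds) := by
    have := h1.mul (by norm_num) (by norm_num) h1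
    norm_num at this
    exact this
  have h5 : HasDecay (4 / 3) ((b * S.ds - S.ds * b) * (S.ds * S.ds)) := by
    have := h2.mul (by norm_num) (by norm_num) h4
    norm_num at this
    exact this
  have h6 : HasDecay (4 / 3) ((S.ds * S.ds) * (b * S.ds - S.ds * b)) := by
    have := h4.mul (by norm_num) (by norm_num) h2
    norm_num at this
    exact this
  have h7 : HasDecay (4 / 3) (S.ds * ((b * S.ds - S.ds * b) * S.ds)) := by
    have := h1.mul (by norm_num) (by norm_num) (h2.mul (by norm_num) (by norm_num) h1)
    norm_num at this
    exact this
  rw [h3]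
  exact (h5.add (by norm_num) h7).add (by norm_num) h6

/-- The noncommutative integral `T ↦ ⨍ T ds³` as a linear form. -/
noncomputable def HasDimension.integral (h : S.HasDimension 3) (ω : DixmierLimit) :
    (H →L[ℂ] H) →ₗ[ℂ] ℂ where
  toFun := S.integral ω 3
  map_add' T T' := by
    rw [SpectralTriple.integral, add_mul, dixmierTrace_add ω (h.hasDecay_mul_ds T)
      (h.hasDecay_mul_ds T'), mul_add]
    rfl
  map_smul' c T := by
    rw [SpectralTriple.integral, smul_mul_assoc, dixmierTrace_smul ω c (h.hasDecay_mul_ds T),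
      mul_left_comm]
    rfl

/-- On the algebra generated by `π(A)` and `[D, π(A)]` the integral is a trace. -/
theorem HasDimension.integral_mul_comm (h : S.HasDimension 3) (hreg : S.IsRegular)
    (ω : DixmierLimit) {b : H →L[ℂ] H} (hb : b ∈ S.diffAlgebra) (T : H →L[ℂ] H) :
    h.integral ω (b * T) = h.integral ω (T * b) := by
  change S.integral ω 3 (b * T) = S.integral ω 3 (T * b)
  rw [SpectralTriple.integral, SpectralTriple.integral]
  congr 1
  -- `T b ds³ = T ds³ b + T [b, ds³]`, and the Dixmier trace of the last term vanishes
  have hc : HasDecay (4 / 3) (T * (b * S.ds ^ 3 - S.ds ^ 3 * b)) :=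
    (h.hasDecay_commutator (hreg b hb 1)).mul_left (by norm_num) T
  have h1 : T * b * S.ds ^ 3 = T * S.ds ^ 3 * b + T * (b * S.ds ^ 3 - S.ds ^ 3 * b) := by
    noncomm_ring
  rw [h1, dixmierTrace_add ω ((h.hasDecay_mul_ds T).mul_right zero_le_one b)
    (hc.mono (by norm_num)), dixmierTrace_eq_zero ω (by norm_num) hc, add_zero, mul_assoc,
    dixmierTrace_mul_comm ω b (h.hasDecay_mul_ds T)]

end SpectralTriple

/-! ### The graded ideal `J` and the current `τ` -/

section Grading

variable {A : Type*} [Ring A] [Algebra ℂ A]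

namespace UForm

open Polynomial in
/-- The algebra morphism `ω ↦ ∑ₖ ω_k X^k`, where `ω_k` is the component of degree `k` of `ω`. -/
noncomputable def gradeHom : UForm A →ₐ[ℂ] Polynomial (UForm A) :=
  lift ((CAlgHom (R := ℂ) (A := UForm A)).comp incl)
    ((((monomial 1 : UForm A →ₗ[UForm A] (UForm A)[X]).restrictScalars ℂ)).comp delta) (by
      intro a b
      simp only [LinearMap.comp_apply, LinearMap.restrictScalars_apply, delta_mul, map_add,
        AlgHom.comp_apply, CAlgHom_apply, C_mul_monomial, monomial_mul_C])

open Polynomial in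
theorem gradeHom_of_mem {k : ℕ} {x : UForm A} (hx : x ∈ degree A k) :
    gradeHom x = monomial k x := by
  have hi : ∀ a : A, gradeHom (incl a) = C (incl a) := fun a => lift_incl _ _ _ a
  have hd : ∀ a : A, gradeHom (delta a) = monomial 1 (delta a) := fun a => lift_delta _ _ _ a
  have h1 : ∀ k : ℕ, ∀ y ∈ LinearMap.range (delta (A := A)) ^ k, gradeHom y = monomial k y := by
    intro k
    induction k with
    | zero =>
      intro y hy
      rw [pow_zero, Submodule.mem_one] at hy
      obtain ⟨c, rfl⟩ := hy
      rw [← (incl (A := A)).commutes, hi, monomial_zero_left]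
    | succ k ih =>
      intro y hy
      rw [pow_succ] at hy
      induction hy using Submodule.mul_induction_on' with
      | mem_mul_mem m hm n hn =>
        obtain ⟨a, rfl⟩ := hn
        rw [map_mul, ih m hm, hd, monomial_mul_monomial]
      | add x _ y _ hx hy => rw [map_add, hx, hy, map_add]
  unfold degree at hx
  induction hx using Submodule.mul_induction_on' with
  | mem_mul_mem m hm n hn =>
    obtain ⟨a, rfl⟩ := hm
    change gradeHom (incl a * n) = monomial k (incl a * n)
    rw [map_mul, h1 k n hn, hi, C_mul_monomial]
  | add x _ y _ hx hy => rw [map_add, hx, hy, map_add]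

end UForm

end Grading

namespace SpectralTriple

variable {H : Type*} [NormedAddCommGroup H] [InnerProductSpace ℂ H] [CompleteSpace H]
  [TopologicalSpace.SeparableSpace H]
variable {A : Type*} [Ring A] [Algebra ℂ A] [StarRing A] [StarModule ℂ A]
variable (S : SpectralTriple A H)

theorem formRep_incl (a : A) : S.formRep (UForm.incl a) = S.rep a := UForm.lift_incl _ _ _ a

theorem formRep_delta (a : A) : S.formRep (UForm.delta a) = S.comm a := UForm.lift_delta _ _ _ a

/-- Forms act through the algebra to which the regularity condition applies. -/
theorem formRep_mem_diffAlgebra (x : UForm A) : S.formRep x ∈ S.diffAlgebra := by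
  induction x using UForm.induction with
  | hi a =>
    rw [formRep_incl]
    exact Algebra.subset_adjoin (Or.inl ⟨a, rfl⟩)
  | hd a =>
    rw [formRep_delta]
    exact Algebra.subset_adjoin (Or.inr ⟨a, rfl⟩)
  | hadd x y hx hy => rw [map_add]; exact add_mem hx hy
  | hmul x y hx hy => rw [map_mul]; exact mul_mem hx hy

/-- In degree `k + 1` the differential ideal `J` is `ker π + d (ker π)`. -/
theorem mem_formKer_sup_of_mem_junk {k : ℕ} {x : UForm A} (hx : x ∈ S.junk)
    (hk : x ∈ UForm.degree A (k + 1)) :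
    x ∈ S.formKer (k + 1) ⊔ (S.formKer k).map UForm.d := by
  -- `J` is spanned by homogeneous elements, so it contains the components of its elements
  have h : (UForm.gradeHom x).coeff (k + 1) ∈ S.formKer (k + 1) ⊔ (S.formKer k).map UForm.d := by
    refine S.junk_induction (P := fun x => (UForm.gradeHom x).coeff (k + 1) ∈
      S.formKer (k + 1) ⊔ (S.formKer k).map UForm.d) ?_ ?_ ?_ hx
    · intro j x hx
      rw [UForm.gradeHom_of_mem hx.1, Polynomial.coeff_monomial]
      split_ifs with h
      · subst h
        exact Submodule.mem_sup_left hx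
      · exact zero_mem _
    · intro j x hx
      rw [UForm.gradeHom_of_mem (UForm.d_mem hx.1), Polynomial.coeff_monomial]
      split_ifs with h
      · obtain rfl : j = k := by omega
        exact Submodule.mem_sup_right ⟨x, hx, rfl⟩
      · exact zero_mem _
    · intro x y hx hy
      rw [map_add, Polynomial.coeff_add]
      exact add_mem hx hy
  rwa [UForm.gradeHom_of_mem hk, Polynomial.coeff_monomial, if_pos rfl] at h

/-- `[D, π(a*)] = -[D, π(a)]*`. -/
theorem comm_star (a : A) : S.comm (star a) = -star (S.comm a) := by
  have hd := S.selfAdjoint.dense_domain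
  refine ContinuousLinearMap.ext fun x => ?_
  refine congrFun (Continuous.ext_on hd (S.comm (star a)).continuous
    (-star (S.comm a)).continuous ?_) x
  intro x hx
  refine hd.eq_of_inner_left ℂ fun y hy => ?_
  obtain ⟨m, e⟩ := S.comm_spec (star a) ⟨x, hx⟩
  obtain ⟨m', e'⟩ := S.comm_spec a ⟨y, hy⟩
  have h1 := S.isFormalAdjoint ⟨_, m⟩ ⟨y, hy⟩
  have h2 := S.isFormalAdjoint ⟨x, hx⟩ ⟨_, m'⟩
  change inner ℂ (S.dirac ⟨S.rep (star a) x, m⟩) y =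
    inner ℂ (S.rep (star a) x) (S.dirac ⟨y, hy⟩) at h1
  change inner ℂ (S.dirac ⟨x, hx⟩) (S.rep a y) = inner ℂ x (S.dirac ⟨S.rep a y, m'⟩) at h2
  rw [← e, neg_apply, inner_neg_left, ContinuousLinearMap.star_eq_adjoint,
    ContinuousLinearMap.adjoint_inner_left, ← e']
  change inner ℂ (_ - S.rep (star a) (S.dirac ⟨x, hx⟩)) y =
    -inner ℂ x (_ - S.rep a (S.dirac ⟨y, hy⟩))
  rw [inner_sub_left, inner_sub_right, h1, ← h2, map_star, ContinuousLinearMap.star_eq_adjoint,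
    ContinuousLinearMap.adjoint_inner_left, ContinuousLinearMap.adjoint_inner_left]
  ring

variable {S}

/-- The linear form `τ(x) = ⨍ π(x) ds³` on `Ω(A)`. -/
noncomputable def HasDimension.formTrace (h : S.HasDimension 3) (ω : DixmierLimit) :
    UForm A →ₗ[ℂ] ℂ := h.integral ω ∘ₗ S.formRep.toLinearMap

theorem HasDimension.formTrace_apply (h : S.HasDimension 3) (ω : DixmierLimit) (x : UForm A) :
    h.formTrace ω x = S.integral ω 3 (S.formRep x) := rfl

theorem HasDimension.formTrace_mul_comm (h : S.HasDimension 3) (hreg : S.IsRegular)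
    (ω : DixmierLimit) (x y : UForm A) : h.formTrace ω (x * y) = h.formTrace ω (y * x) := by
  have := h.integral_mul_comm hreg ω (S.formRep_mem_diffAlgebra x) (S.formRep y)
  rwa [← map_mul, ← map_mul] at this

/-- `τ` is a closed current: `∫ dη = 0` for 2-forms `η`. -/
theorem HasDimension.formTrace_d (h : S.HasDimension 3) (ω : DixmierLimit)
    (hclosed : S.IsClosed ω) {x : UForm A} (hx : x ∈ UForm.degree A 2) :
    h.formTrace ω (UForm.d x) = 0 := by
  unfold UForm.degree at hx
  rw [pow_two] at hx
  induction hx using Submodule.mul_induction_on' with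
  | mem_mul_mem m hm n hn =>
    obtain ⟨a, rfl⟩ := hm
    induction hn using Submodule.mul_induction_on' with
    | mem_mul_mem m hm n hn =>
      obtain ⟨b, rfl⟩ := hm
      obtain ⟨c, rfl⟩ := hn
      change h.formTrace ω (UForm.d (UForm.incl a * (UForm.delta b * UForm.delta c))) = 0
      simp only [UForm.d_mul, UForm.d_incl, UForm.d_delta, zero_mul, mul_zero, add_zero]
      rw [h.formTrace_apply, map_mul, map_mul, formRep_delta, formRep_delta, formRep_delta,
        SpectralTriple.integral, ← mul_assoc, hclosed a b c, mul_zero]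
    | add x _ y _ hx hy => rw [mul_add, map_add, map_add, hx, hy, add_zero]
  | add x _ y _ hx hy => rw [map_add, map_add, hx, hy, add_zero]

/-- `τ` vanishes on `J ∩ Ω³(A)`, so it is well defined on `Ω_D³(A)`. -/
theorem HasDimension.formTrace_eq_zero_of_mem_junk (h : S.HasDimension 3) (ω : DixmierLimit)
    (hclosed : S.IsClosed ω) {x : UForm A} (hx : x ∈ S.junk) (h3 : x ∈ UForm.degree A 3) :
    h.formTrace ω x = 0 := by
  obtain ⟨y, hy, _, ⟨z, hz, rfl⟩, rfl⟩ :=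
    Submodule.mem_sup.1 (S.mem_formKer_sup_of_mem_junk hx h3)
  have h1 : S.formRep y = 0 := hy.2
  rw [map_add, h.formTrace_d ω hclosed hz.1, add_zero]
  change h.integral ω (S.formRep y) = 0
  rw [h1, map_zero]

/-! ### Matrices of forms -/

section MatrixForms

variable {N : ℕ}

/-- The closed trace `X ↦ ⨍ tr(π(X)) ds³` on `M_N(Ω(A))`. -/
noncomputable def HasDimension.matrixTrace (h : S.HasDimension 3) (ω : DixmierLimit) (N : ℕ) :
    Matrix (Fin N) (Fin N) (UForm A) →ₗ[ℂ] ℂ :=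
  h.formTrace ω ∘ₗ Matrix.traceLinearMap (Fin N) ℂ (UForm A)

theorem HasDimension.matrixTrace_apply (h : S.HasDimension 3) (ω : DixmierLimit)
    (X : Matrix (Fin N) (Fin N) (UForm A)) :
    h.matrixTrace ω N X = S.integral ω 3 (X.map S.formRep).trace := by
  change S.integral ω 3 (S.formRep (∑ i, X i i)) = S.integral ω 3 (∑ i, S.formRep (X i i))
  rw [map_sum]

theorem HasDimension.matrixTrace_mul_comm (h : S.HasDimension 3) (hreg : S.IsRegular)
    (ω : DixmierLimit) (X Y : Matrix (Fin N) (Fin N) (UForm A)) :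
    h.matrixTrace ω N (X * Y) = h.matrixTrace ω N (Y * X) := by
  change h.formTrace ω (∑ i, (X * Y) i i) = h.formTrace ω (∑ i, (Y * X) i i)
  simp only [Matrix.mul_apply, map_sum]
  rw [Finset.sum_comm]
  exact Finset.sum_congr rfl fun i _ => Finset.sum_congr rfl fun j _ =>
    h.formTrace_mul_comm hreg ω _ _

theorem HasDimension.matrixTrace_d (h : S.HasDimension 3) (ω : DixmierLimit)
    (hclosed : S.IsClosed ω) {X : Matrix (Fin N) (Fin N) (UForm A)}
    (hX : ∀ i j, X i j ∈ UForm.degree A 2) : h.matrixTrace ω N (X.map UForm.d) = 0 := by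
  change h.formTrace ω (∑ i, UForm.d (X i i)) = 0
  rw [map_sum]
  exact Finset.sum_eq_zero fun i _ => h.formTrace_d ω hclosed (hX i i)

end MatrixForms

end SpectralTriple

section MatrixForms

variable {A : Type*} [Ring A] [Algebra ℂ A] {N : ℕ}

namespace UForm

theorem matrix_mul_mem_degree {p q : ℕ} {X Y : Matrix (Fin N) (Fin N) (UForm A)}
    (hX : ∀ i j, X i j ∈ degree A p) (hY : ∀ i j, Y i j ∈ degree A q) (i j : Fin N) :
    (X * Y) i j ∈ degree A (p + q) := by
  rw [Matrix.mul_apply]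
  exact sum_mem fun k _ => mul_mem_degree (hX i k) (hY k j)

/-- The graded Leibniz rule for matrices of forms. -/
theorem matrix_d_mul {p : ℕ} {X : Matrix (Fin N) (Fin N) (UForm A)}
    (hX : ∀ i j, X i j ∈ degree A p) (Y : Matrix (Fin N) (Fin N) (UForm A)) :
    (X * Y).map d = X.map d * Y + (-1 : ℂ) ^ p • (X * Y.map d) := by
  ext i j
  simp only [Matrix.map_apply, Matrix.mul_apply, Matrix.add_apply, Matrix.smul_apply, map_sum,
    d_mul, sgn_of_mem (hX i _), Finset.sum_add_distrib, Finset.smul_sum, smul_mul_assoc]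

end UForm

end MatrixForms

/-! ### The gauge variation of the Chern–Simons form -/

/-- The Chern–Simons computation in an algebra with a trace `t`. Here `b = u a u⁻¹`, and `e`
stands for `u da u⁻¹`, so that `e - θ b - b θ - θ²` is the differential of `b + θ`. -/
theorem trace_chernSimons_gauge {M : Type*} [Ring M] [Algebra ℂ M] (t : M →ₗ[ℂ] ℂ)
    (ht : ∀ x y, t (x * y) = t (y * x)) {u v a a' θ : M} (hvu : v * u = 1)
    (hclosed : t (θ * (u * a' * v)) = t (θ * (θ * (u * a * v)))) :
    t ((u * a * v + θ) * (u * a' * v - θ * (u * a * v) - u * a * v * θ - θ * θ) +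
        (2 / 3 : ℂ) • (u * a * v + θ) ^ 3) =
      t (a * a' + (2 / 3 : ℂ) • a ^ 3) - 1 / 3 * t (θ ^ 3) := by
  have conj : ∀ x, t (u * x * v) = t x := fun x => by rw [ht, ← mul_assoc, hvu, one_mul]
  have hmul : ∀ x y, u * x * v * (u * y * v) = u * (x * y) * v := fun x y => by
    calc _ = u * x * (v * u) * y * v := by noncomm_ring
      _ = _ := by rw [hvu]; noncomm_ring
  have h1 : t (u * a * v * (u * a' * v)) = t (a * a') := by rw [hmul, conj]
  have h2 : t ((u * a * v) ^ 3) = t (a ^ 3) := by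
    rw [pow_three, hmul, hmul, conj, pow_three]
  generalize u * a * v = b at *
  generalize u * a' * v = e at *
  have c1 : t (b * (θ * b)) = t (b * (b * θ)) := by rw [← mul_assoc, ht]
  have c2 : t (θ * (b * b)) = t (b * (b * θ)) := by rw [ht, mul_assoc]
  have c3 : t (θ * (b * θ)) = t (b * (θ * θ)) := by rw [ht, mul_assoc]
  have c4 : t (θ * (θ * b)) = t (b * (θ * θ)) := by rw [← mul_assoc, ht]
  rw [pow_three] at h2
  simp only [pow_three, map_add, map_smul, smul_eq_mul, mul_add, add_mul, mul_sub, map_sub,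
    mul_assoc] at *
  rw [h1, h2, c1, c2, c3, hclosed, c4]
  ring

section UniversalGauge

variable {A : Type*} [Ring A] [Algebra ℂ A] {N : ℕ}

namespace UForm

/-- The Chern–Simons form of a matrix of universal 1-forms. -/
noncomputable def universalCS (α : Matrix (Fin N) (Fin N) (UForm A)) :
    Matrix (Fin N) (Fin N) (UForm A) :=
  α * α.map UForm.d + (2 / 3 : ℂ) • α ^ 3

/-- The gauge transform of a matrix of universal 1-forms. -/
noncomputable def universalGauge [StarRing A] (u : unitary (Matrix (Fin N) (Fin N) A))
    (α : Matrix (Fin N) (Fin N) (UForm A)) : Matrix (Fin N) (Fin N) (UForm A) :=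
  (u : Matrix (Fin N) (Fin N) A).map UForm.incl * α *
      (u⁻¹ : unitary (Matrix (Fin N) (Fin N) A)).1.map UForm.incl +
    (u : Matrix (Fin N) (Fin N) A).map UForm.incl *
      (u⁻¹ : unitary (Matrix (Fin N) (Fin N) A)).1.map UForm.delta

theorem universalGauge_mem [StarRing A] (u : unitary (Matrix (Fin N) (Fin N) A))
    {α : Matrix (Fin N) (Fin N) (UForm A)} (hα : ∀ i j, α i j ∈ UForm.degree A 1) (i j : Fin N) :
    universalGauge u α i j ∈ UForm.degree A 1 := by
  have hU : ∀ w : Matrix (Fin N) (Fin N) A, ∀ i j, w.map UForm.incl i j ∈ UForm.degree A 0 :=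
    fun w i j => UForm.incl_mem _
  have hd : ∀ w : Matrix (Fin N) (Fin N) A, ∀ i j, w.map UForm.delta i j ∈ UForm.degree A 1 :=
    fun w i j => UForm.delta_mem _
  exact add_mem (UForm.matrix_mul_mem_degree (UForm.matrix_mul_mem_degree (hU _) hα) (hU _) i j)
    (UForm.matrix_mul_mem_degree (hU _) (hd _) i j)

end UForm

end UniversalGauge

section GaugeDifferential

variable {A : Type*} [Ring A] [Algebra ℂ A] {N : ℕ}
variable {U V α θ : Matrix (Fin N) (Fin N) (UForm A)}

namespace UForm

theorem matrix_d_one : (1 : Matrix (Fin N) (Fin N) (UForm A)).map d = 0 := by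
  refine Matrix.ext fun i j => ?_
  rw [Matrix.map_apply, Matrix.one_apply]
  split_ifs
  · rw [← map_one incl, d_incl, delta_one]; rfl
  · rw [map_zero]; rfl

theorem mul_matrix_d_mem (hU : ∀ i j, U i j ∈ degree A 0) (hV : ∀ i j, V i j ∈ degree A 0)
    (i j : Fin N) : (U * V.map d) i j ∈ degree A 1 := by
  have hdV : ∀ i j, V.map d i j ∈ degree A 1 := fun i j => d_mem (hV i j)
  have h := matrix_mul_mem_degree hU hdV i j
  rwa [zero_add] at h

theorem matrix_conj_mem (hU : ∀ i j, U i j ∈ degree A 0) (hV : ∀ i j, V i j ∈ degree A 0)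
    (hα : ∀ i j, α i j ∈ degree A 1) (i j : Fin N) : (U * α * V) i j ∈ degree A 1 := by
  have h := matrix_mul_mem_degree (matrix_mul_mem_degree hU hα) hV i j
  rwa [zero_add] at h

/-- `du = -θ u` for `θ = u du⁻¹`. -/
theorem matrix_d_eq_neg_mul (hU : ∀ i j, U i j ∈ degree A 0) (hUV : U * V = 1) (hVU : V * U = 1)
    (hθ : U * V.map d = θ) : U.map d = -(θ * U) := by
  have h1 := matrix_d_mul hU V
  rw [hUV, matrix_d_one, pow_zero, one_smul, hθ] at h1
  have h2 : U.map d * V = -θ := eq_neg_of_add_eq_zero_left h1.symm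
  calc U.map d = U.map d * V * U := by rw [mul_assoc, hVU, mul_one]
    _ = -(θ * U) := by rw [h2, neg_mul]

/-- The Maurer–Cartan equation `dθ = -θ²` for `θ = u du⁻¹`. -/
theorem matrix_d_maurerCartan (hU : ∀ i j, U i j ∈ degree A 0) (hUV : U * V = 1) (hVU : V * U = 1)
    (hθ : U * V.map d = θ) : θ.map d = -(θ * θ) := by
  have hdd : (V.map d).map d = 0 := Matrix.ext fun i j => d_d _
  have h1 := matrix_d_mul hU (V.map d)
  rwa [hdd, mul_zero, smul_zero, add_zero, matrix_d_eq_neg_mul hU hUV hVU hθ, neg_mul, mul_assoc,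
    hθ] at h1

theorem matrix_d_conj (hU : ∀ i j, U i j ∈ degree A 0) (hα : ∀ i j, α i j ∈ degree A 1)
    (hUV : U * V = 1) (hVU : V * U = 1) (hθ : U * V.map d = θ) :
    (U * α * V).map d = U * α.map d * V - θ * (U * α * V) - U * α * V * θ := by
  have h1 : (U * α * V) * θ = U * α * V.map d := by
    rw [← hθ, ← mul_assoc, mul_assoc (U * α), hVU, mul_one]
  have hUα : ∀ i j, (U * α) i j ∈ degree A 1 := fun i j => by
    have h := matrix_mul_mem_degree hU hα i j
    rwa [zero_add] at h
  rw [h1, matrix_d_mul hUα, matrix_d_mul hU, matrix_d_eq_neg_mul hU hUV hVU hθ]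
  simp only [pow_one, pow_zero, one_smul, neg_smul, neg_mul, add_mul, mul_assoc]
  abel

end UForm

end GaugeDifferential

namespace SpectralTriple

variable {H : Type*} [NormedAddCommGroup H] [InnerProductSpace ℂ H] [CompleteSpace H]
  [TopologicalSpace.SeparableSpace H]
variable {A : Type*} [Ring A] [Algebra ℂ A] [StarRing A] [StarModule ℂ A]
variable {S : SpectralTriple A H} {N : ℕ}

/-- The closedness of `τ` applied to the 2-form `θ (u α u⁻¹)`. -/
theorem HasDimension.matrixTrace_theta_mul (h : S.HasDimension 3) (hreg : S.IsRegular)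
    (ω : DixmierLimit) (hclosed : S.IsClosed ω) {U V α θ : Matrix (Fin N) (Fin N) (UForm A)}
    (hU : ∀ i j, U i j ∈ UForm.degree A 0) (hV : ∀ i j, V i j ∈ UForm.degree A 0)
    (hα : ∀ i j, α i j ∈ UForm.degree A 1) (hUV : U * V = 1) (hVU : V * U = 1)
    (hθ : U * V.map UForm.d = θ) :
    h.matrixTrace ω N (θ * (U * α.map UForm.d * V)) =
      h.matrixTrace ω N (θ * (θ * (U * α * V))) := by
  have hθ1 : ∀ i j, θ i j ∈ UForm.degree A 1 := by
    rw [← hθ]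
    exact UForm.mul_matrix_d_mem hU hV
  have hβ1 := UForm.matrix_conj_mem hU hV hα
  have h2 : ∀ i j, (θ * (U * α * V)) i j ∈ UForm.degree A (1 + 1) := fun i j =>
    UForm.matrix_mul_mem_degree hθ1 hβ1 i j
  rw [one_add_one_eq_two] at h2
  have h1 := h.matrixTrace_d ω hclosed h2
  rw [UForm.matrix_d_mul hθ1, UForm.matrix_d_conj hU hα hUV hVU hθ,
    UForm.matrix_d_maurerCartan hU hUV hVU hθ] at h1
  generalize U * α.map UForm.d * V = e at h1 ⊢
  generalize U * α * V = b at h1 ⊢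
  have h3 : -(θ * θ) * b + (-1 : ℂ) ^ 1 • (θ * (e - θ * b - b * θ)) =
      (θ * b) * θ - θ * e := by
    simp only [pow_one, neg_smul, one_smul, neg_mul, mul_sub, mul_assoc]
    abel
  rw [h3, map_sub, h.matrixTrace_mul_comm hreg ω (θ * b) θ] at h1
  exact (sub_eq_zero.1 h1).symm

/-- The gauge variation of the Chern-Simons action, for universal forms. -/
theorem HasDimension.matrixTrace_universalGauge (h : S.HasDimension 3) (hreg : S.IsRegular)
    (ω : DixmierLimit) (hclosed : S.IsClosed ω) (u : unitary (Matrix (Fin N) (Fin N) A))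
    {α : Matrix (Fin N) (Fin N) (UForm A)} (hα : ∀ i j, α i j ∈ UForm.degree A 1) :
    h.matrixTrace ω N (UForm.universalCS (UForm.universalGauge u α)) =
      h.matrixTrace ω N (UForm.universalCS α) - 1 / 3 * h.matrixTrace ω N
        (((u : Matrix (Fin N) (Fin N) A).map UForm.incl *
          (u⁻¹ : unitary (Matrix (Fin N) (Fin N) A)).1.map UForm.delta) ^ 3) := by
  have hinc : ∀ w w' : Matrix (Fin N) (Fin N) A, w * w' = 1 →
      w.map UForm.incl * w'.map UForm.incl = (1 : Matrix (Fin N) (Fin N) (UForm A)) := by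
    intro w w' e
    have h1 := Matrix.map_mul (L := w) (M := w') (f := (UForm.incl : A →ₐ[ℂ] UForm A))
    rw [e, Matrix.map_one _ (map_zero _) (map_one _)] at h1
    exact h1.symm
  have hUV := hinc _ _ (congrArg Subtype.val (mul_inv_cancel u))
  have hVU := hinc _ _ (congrArg Subtype.val (inv_mul_cancel u))
  have hmem : ∀ w : Matrix (Fin N) (Fin N) A, ∀ i j, w.map UForm.incl i j ∈ UForm.degree A 0 :=
    fun w i j => UForm.incl_mem _
  have hU := hmem (u : Matrix (Fin N) (Fin N) A)
  have hV := hmem (u⁻¹ : unitary (Matrix (Fin N) (Fin N) A)).1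
  have hdV : ((u⁻¹ : unitary (Matrix (Fin N) (Fin N) A)).1.map UForm.incl).map UForm.d =
      (u⁻¹ : unitary (Matrix (Fin N) (Fin N) A)).1.map UForm.delta :=
    Matrix.ext fun i j => UForm.d_incl _
  rw [UForm.universalGauge, ← hdV]
  generalize (u : Matrix (Fin N) (Fin N) A).map UForm.incl = U at *
  generalize (u⁻¹ : unitary (Matrix (Fin N) (Fin N) A)).1.map UForm.incl = V at *
  generalize hθ : U * V.map UForm.d = θ
  have hd : (U * α * V + θ).map UForm.d =
      U * α.map UForm.d * V - θ * (U * α * V) - U * α * V * θ - θ * θ := by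
    rw [Matrix.map_add _ (map_add _), UForm.matrix_d_conj hU hα hUV hVU hθ,
      UForm.matrix_d_maurerCartan hU hUV hVU hθ, ← sub_eq_add_neg]
  rw [UForm.universalCS, UForm.universalCS, hd]
  exact trace_chernSimons_gauge (h.matrixTrace ω N) (h.matrixTrace_mul_comm hreg ω) hVU
    (h.matrixTrace_theta_mul hreg ω hclosed hU hV hα hUV hVU hθ)

theorem HasDimension.integral_trace_eq (h : S.HasDimension 3) (ω : DixmierLimit)
    (hclosed : S.IsClosed ω) {V : S.Potential N} {K K' : Matrix (Fin N) (Fin N) (H →L[ℂ] H)}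
    (hK : S.IsRepresentative V K) (hK' : S.IsRepresentative V K') :
    S.integral ω 3 K.trace = S.integral ω 3 K'.trace := by
  obtain ⟨κ, h3, hκ, rfl⟩ := hK
  obtain ⟨κ', h3', hκ', rfl⟩ := hK'
  rw [← h.matrixTrace_apply, ← h.matrixTrace_apply, ← sub_eq_zero, ← map_sub]
  change h.formTrace ω (∑ i, (κ i i - κ' i i)) = 0
  rw [map_sum]
  refine Finset.sum_eq_zero fun i _ =>
    h.formTrace_eq_zero_of_mem_junk ω hclosed ?_ (sub_mem (h3 i i) (h3' i i))
  have h1 : S.toForm (κ i i) = S.toForm (κ' i i) :=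
    congrFun (congrFun (hκ.trans hκ'.symm) i) i
  exact (Ideal.Quotient.eq (I := S.junkIdeal)).1 h1

theorem HasDimension.csAction_eq (h : S.HasDimension 3) (ω : DixmierLimit)
    (hclosed : S.IsClosed ω) {V : S.Potential N} {K : Matrix (Fin N) (Fin N) (H →L[ℂ] H)}
    (hK : S.IsRepresentative V K) : S.integral ω 3 K.trace = S.csAction ω V :=
  h.integral_trace_eq ω hclosed hK (S.exists_representative V).choose_spec

theorem isRepresentative_universalCS {V : S.Potential N} {α : Matrix (Fin N) (Fin N) (UForm A)}
    (hα : ∀ i j, α i j ∈ UForm.degree A 1) (hV : ∀ i j, S.toForm (α i j) = V i j) :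
    S.IsRepresentative V ((UForm.universalCS α).map S.formRep) := by
  refine ⟨UForm.universalCS α, ?_, ?_, rfl⟩
  · intro i j
    have hd : ∀ i j, α.map UForm.d i j ∈ UForm.degree A 2 := fun i j => UForm.d_mem (hα i j)
    have h3 : (α ^ 3) i j ∈ UForm.degree A 3 := by
      rw [pow_three]
      exact UForm.matrix_mul_mem_degree hα (UForm.matrix_mul_mem_degree hα hα) i j
    exact add_mem (UForm.matrix_mul_mem_degree hα hd i j) (Submodule.smul_mem _ _ h3)
  · have h1 : V.map Subtype.val = α.map S.toForm := by
      ext i j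
      exact (hV i j).symm
    rw [csForm, h1, UForm.universalCS, Matrix.map_add _ (map_add _), Matrix.map_mul,
      Matrix.map_smul _ _ (fun x => map_smul _ _ x)]
    have h3 : (α ^ 3).map S.toForm = α.map S.toForm ^ 3 := Matrix.map_pow _ _ _
    rw [h3]
    rfl

theorem toForm_universalGauge {V : S.Potential N} {α : Matrix (Fin N) (Fin N) (UForm A)}
    (hV : ∀ i j, S.toForm (α i j) = V i j) (u : unitary (Matrix (Fin N) (Fin N) A))
    (i j : Fin N) : S.toForm (UForm.universalGauge u α i j) = S.gaugeTransform u V i j := by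
  have h1 : V.map Subtype.val = α.map S.toForm := by
    ext i j
    exact (hV i j).symm
  have h2 : (UForm.universalGauge u α).map S.toForm =
      (S.gaugeTransform u V).map Subtype.val := by
    rw [UForm.universalGauge, Matrix.map_add _ (map_add _), Matrix.map_mul, Matrix.map_mul,
      Matrix.map_mul, ← h1]
    have h3 : ((u⁻¹ : unitary (Matrix (Fin N) (Fin N) A)).1.map UForm.delta).map S.toForm =
        ((u⁻¹ : unitary (Matrix (Fin N) (Fin N) A)).1.map fun a =>
          S.toForm (UForm.incl a)).map S.dForm :=
      Matrix.ext fun i j => congrArg S.toForm (UForm.d_incl _).symm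
    rw [h3]
    rfl
  exact congrFun (congrFun h2 i) j

theorem formRep_universalTheta_cube (u v : Matrix (Fin N) (Fin N) A) :
    ((u.map UForm.incl * v.map UForm.delta) ^ 3).map S.formRep =
      (u.map S.rep * v.map S.comm) ^ 3 := by
  have h1 : (u.map UForm.incl).map S.formRep = u.map S.rep :=
    Matrix.ext fun i j => S.formRep_incl _
  have h2 : (v.map UForm.delta).map S.formRep = v.map S.comm :=
    Matrix.ext fun i j => S.formRep_delta _
  rw [← h1, ← h2, ← Matrix.map_mul]
  exact Matrix.map_pow _ _ _

theorem isHermitian_universalGauge {α : Matrix (Fin N) (Fin N) (UForm A)}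
    (hα : (α.map S.formRep).IsHermitian) (u : unitary (Matrix (Fin N) (Fin N) A)) :
    ((UForm.universalGauge u α).map S.formRep).IsHermitian := by
  have hinv : (u⁻¹ : unitary (Matrix (Fin N) (Fin N) A)).1 = star (u : Matrix (Fin N) (Fin N) A) :=
    rfl
  have hU : ((u : Matrix (Fin N) (Fin N) A).map UForm.incl).map S.formRep =
      (u : Matrix (Fin N) (Fin N) A).map S.rep := by
    exact Matrix.ext fun i j => S.formRep_incl _
  have hV : ((u⁻¹ : unitary (Matrix (Fin N) (Fin N) A)).1.map UForm.incl).map S.formRep =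
      ((u : Matrix (Fin N) (Fin N) A).map S.rep).conjTranspose := by
    rw [hinv]
    exact Matrix.ext fun i j => (S.formRep_incl _).trans (map_star S.rep _)
  have hW : ((u⁻¹ : unitary (Matrix (Fin N) (Fin N) A)).1.map UForm.delta).map S.formRep =
      -((u : Matrix (Fin N) (Fin N) A).map S.comm).conjTranspose := by
    rw [hinv]
    exact Matrix.ext fun i j => (S.formRep_delta _).trans (S.comm_star _)
  have hleib : (u : Matrix (Fin N) (Fin N) A).map S.comm *
        ((u : Matrix (Fin N) (Fin N) A).map S.rep).conjTranspose =
      (u : Matrix (Fin N) (Fin N) A).map S.rep *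
        ((u : Matrix (Fin N) (Fin N) A).map S.comm).conjTranspose := by
    have h1 : (u : Matrix (Fin N) (Fin N) A) * star (u : Matrix (Fin N) (Fin N) A) = 1 :=
      Unitary.coe_mul_star_self u
    have hc1 : S.comm 1 = 0 := by simpa using S.comm_mul 1 1
    rw [← sub_eq_zero]
    refine Matrix.ext fun i j => ?_
    have h2 := congrArg S.comm (congrFun (congrFun h1 i) j)
    have h3 : S.comm ((1 : Matrix (Fin N) (Fin N) A) i j) = 0 := by
      rw [Matrix.one_apply]
      split_ifs
      · exact hc1
      · exact map_zero _
    rw [h3, Matrix.mul_apply, map_sum] at h2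
    simp only [Matrix.sub_apply, Matrix.mul_apply, Matrix.map_apply, Matrix.conjTranspose_apply,
      Matrix.zero_apply]
    rw [← Finset.sum_sub_distrib, ← h2]
    refine Finset.sum_congr rfl fun k _ => ?_
    rw [S.comm_mul, Matrix.star_apply, S.comm_star, map_star, mul_neg, sub_eq_add_neg]
  rw [UForm.universalGauge, Matrix.map_add _ (map_add _), Matrix.map_mul, Matrix.map_mul, Matrix.map_mul,
    hU, hV, hW]
  refine Matrix.IsHermitian.add (Matrix.isHermitian_mul_mul_conjTranspose _ hα) ?_
  rw [Matrix.IsHermitian, Matrix.conjTranspose_mul, Matrix.conjTranspose_neg,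
    Matrix.conjTranspose_conjTranspose, neg_mul, hleib, mul_neg]

end SpectralTriple

end NCCS

theorem theorem3p1 {A : Type*} [Ring A] [Algebra ℂ A] [StarRing A] [StarModule ℂ A]
    {H : Type*} [NormedAddCommGroup H] [InnerProductSpace ℂ H] [CompleteSpace H]
    [TopologicalSpace.SeparableSpace H]
    (S : NCCS.SpectralTriple A H) (hdim : S.HasDimension 3) (hreg : S.IsRegular)
    (ω : NCCS.DixmierLimit) (hclosed : S.IsClosed ω)
    {N : ℕ} (V : S.Potential N) (hV : S.IsHermitian V)
    (u : unitary (Matrix (Fin N) (Fin N) A)) :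
    S.IsHermitian (S.gaugeTransform u V) ∧
      (∀ K, S.IsRepresentative V K → S.integral ω 3 K.trace = S.csAction ω V) ∧
      S.csAction ω (S.gaugeTransform u V) = S.csAction ω V + S.gaugeAnomaly ω u := by
  obtain ⟨α, hα, hαV, hαh⟩ := hV
  have hα' := NCCS.UForm.universalGauge_mem u hα
  have hαV' := NCCS.SpectralTriple.toForm_universalGauge hαV u
  refine ⟨⟨_, hα', hαV', NCCS.SpectralTriple.isHermitian_universalGauge hαh u⟩,
    fun K hK => hdim.csAction_eq ω hclosed hK, ?_⟩
  rw [← hdim.csAction_eq ω hclosed (NCCS.SpectralTriple.isRepresentative_universalCS hα hαV),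
    ← hdim.csAction_eq ω hclosed (NCCS.SpectralTriple.isRepresentative_universalCS hα' hαV'),
    ← hdim.matrixTrace_apply, ← hdim.matrixTrace_apply,
    hdim.matrixTrace_universalGauge hreg ω hclosed u hα, hdim.matrixTrace_apply ω (_ ^ 3)]
  rw [NCCS.SpectralTriple.gaugeAnomaly, NCCS.SpectralTriple.formRep_universalTheta_cube]
  ring
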